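/- A hyperfield is a set $F$ with a commutative multiplication and a commutative multivalued addition $\boxplus$ (with non-empty values, extended to subsets by taking unions) such that: $\boxplus$ is associative; $0\boxplus x=\{x\}$; every $x$ has a unique hyperinverse $-x$ with $0\in x\boxplus(-x)$; $x\in y\boxplus z$ if and only if $z\in x\boxplus(-y)$; multiplication is associative with unit $1\neq 0$, $0$ is absorbing, and every non-zero element is invertible; and $a(x\boxplus y)=ax\boxplus ay$. An involution of $F$ is a map $x\mapsto\bar x$ preserving $\boxplus$, multiplication, $0$ and $1$ whose square is the identity (for example the identity map). Let $E$ be a finite set. The support of $X\in F^E$ is $\underline X=\{e\in E: X(e)\ne 0\}$. Consider the following axioms for a set $\mathcal C\subseteq F^E$. - (C0) $0\notin\mathcal C$. - (C1) If $X\in\mathcal C$ and $\alpha\in F^\times$, then $\alpha X\in\mathcal C$. - (C2) If $X,Y\in\mathcal C$ and $\underline X\subseteq\underline Y$, then $X=\alpha Y$ for some $\alpha\in F^\times$. - (C3)$'$ If $X,Y\in\mathcal C$ are such that $\underline X\neq\underline Y$ and $\underline X\cup\underline Y$ does not properly contain a union of two distinct supports of elements of $\mathcal C$, and if $X(e)=-Y(e)\neq0$,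 then there is $Z\in\mathcal C$ with $Z(e)=0$ and $Z(f)\in X(f)\boxplus Y(f)$ for all $f\in E$. - (C3) Suppose $X,X_1,\dots,X_k\in\mathcal C$ have distinct supports, the union of these $k+1$ supports has height $k+1$ in the lattice of all unions of supports of elements of $\mathcal C$, and $\underline X\not\subseteq\bigcup_{i}\underline X_i$. Suppose $e_i\in(\underline X\cap\underline X_i)\setminus\bigcup_{j\ne i}\underline X_j$ and $X(e_i)=-X_i(e_i)$ for $1\le i\le k$. Then there is $Z\in\mathcal C$ with $Z(e_i)=0$ for all $i$ and $Z(f)\in X(f)\boxplus X_1(f)\boxplus\cdots\boxplus X_k(f)$ for all $f\in E$. The set $\mathcal C$ is the circuit set of a weak $F$-matroid on $E$ if it satisfies (C0), (C1), (C2) and (C3)$'$, and of a strong $F$-matroid on $E$ if it satisfies (C0), (C1), (C2) and (C3). Fix an involution $x\mapsto\bar x$ of $F$. For $X,Y\in F^E$ write $X\perp Y$ if $0$ lies in the hypersum of the elements $X(e)\,\overline{Y(e)}$, $e\in E$ (the empty hypersum being $\{0\}$), and let $S^\perp=\{X\in F^E: X\perp Y\text{ for all }Y\in S\}$. For a strong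 $F$-matroid with circuit set $\mathcal C$, the set $\mathcal C^*$ of cocircuits consists of the elements of $\mathcal C^\perp\setminus\{0\}$ of minimal support; a vector is an element of $(\mathcal C^*)^\perp$ and a covector is an element of $\mathcal C^\perp$. The hyperfield $F$ is called perfect if, for every strong $F$-matroid on a finite set, every vector $V$ and every covector $W$ satisfy $V\perp W$. **Theorem 5.4.** Every weak $F$-matroid over a perfect hyperfield $F$ (with an involution) is a strong $F$-matroid; that is, if $\mathcal C\subseteq F^E$ satisfies (C0), (C1), (C2) and (C3)$'$, then it satisfies (C3). -/

import Mathlib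

universe u v w

/-- A (commutative) hyperfield.  The multiplicative structure (commutative monoid with absorbing
zero, `0 ≠ 1`, inverses of nonzero elements) is Mathlib's `CommGroupWithZero`; the addition `hadd`
is multivalued, and `-x` is the hyperinverse of `x`. -/
class Hyperfield (F : Type u) extends CommGroupWithZero F, Neg F where
  hadd : F → F → Set F
  hadd_nonempty : ∀ x y, (hadd x y).Nonempty
  hadd_comm : ∀ x y, hadd x y = hadd y x
  hadd_assoc : ∀ x y z, (⋃ t ∈ hadd y z, hadd x t) = ⋃ t ∈ hadd x y, hadd t z
  zero_hadd : ∀ x, hadd 0 x = {x}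
  zero_mem_hadd_neg : ∀ x, (0 : F) ∈ hadd x (-x)
  eq_neg_of_zero_mem : ∀ x y, (0 : F) ∈ hadd x y → y = -x
  mem_hadd_iff : ∀ x y z, x ∈ hadd y z ↔ z ∈ hadd x (-y)
  mul_hadd : ∀ a x y, (fun t => a * t) '' hadd x y = hadd (a * x) (a * y)

namespace Hyperfield

section Hypersum

variable {F : Type u} [Hyperfield F]

/-- Hyperaddition of sets: the union of all `a ⊞ b` with `a ∈ A` and `b ∈ B`. -/
def setAdd (A B : Set F) : Set F := {c | ∃ a ∈ A, ∃ b ∈ B, c ∈ hadd a b}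

theorem setAdd_comm (A B : Set F) : setAdd A B = setAdd B A := by
  ext c
  constructor
  · rintro ⟨a, ha, b, hb, h⟩
    exact ⟨b, hb, a, ha, hadd_comm a b ▸ h⟩
  · rintro ⟨a, ha, b, hb, h⟩
    exact ⟨b, hb, a, ha, hadd_comm a b ▸ h⟩

theorem zero_setAdd (A : Set F) : setAdd {0} A = A := by
  ext c
  simp [setAdd, zero_hadd]

theorem setAdd_assoc (A B C : Set F) : setAdd (setAdd A B) C = setAdd A (setAdd B C) := by
  ext d
  constructor
  · rintro ⟨s, ⟨a, ha, b, hb, hs⟩, c, hc, hd⟩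
    have h : d ∈ ⋃ t ∈ hadd a b, hadd t c := Set.mem_biUnion hs hd
    rw [← hadd_assoc] at h
    simp only [Set.mem_iUnion] at h
    obtain ⟨t, ht, hdt⟩ := h
    exact ⟨a, ha, t, ⟨b, hb, c, hc, ht⟩, hdt⟩
  · rintro ⟨a, ha, t, ⟨b, hb, c, hc, ht⟩, hd⟩
    have h : d ∈ ⋃ t ∈ hadd b c, hadd a t := Set.mem_biUnion ht hd
    rw [hadd_assoc] at h
    simp only [Set.mem_iUnion] at h
    obtain ⟨s, hs, hds⟩ := h
    exact ⟨s, ⟨a, ha, b, hb, hs⟩, c, hc, hds⟩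

/-- Subsets of a hyperfield form a commutative monoid under hyperaddition, with neutral element
`{0}`; hypersums of finite families are sums in this monoid. -/
@[reducible] def setAddCommMonoid (F : Type u) [Hyperfield F] : AddCommMonoid (Set F) where
  add := setAdd
  zero := {0}
  add_assoc := setAdd_assoc
  zero_add := zero_setAdd
  add_zero A := (setAdd_comm A {0}).trans (zero_setAdd A)
  add_comm := setAdd_comm
  nsmul := @nsmulRec (Set F) ⟨({0} : Set F)⟩ ⟨setAdd⟩

/-- The hypersum `⊞_{i ∈ s} x i` of a finite family of elements. The empty hypersum is `{0}`. -/
def hsum {ι : Type w} (s : Finset ι) (x : ι → F) : Set F :=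
  letI := setAddCommMonoid F
  ∑ i ∈ s, ({x i} : Set F)

theorem hsum_empty {ι : Type w} (x : ι → F) : hsum (∅ : Finset ι) x = {0} := by
  let _ := setAddCommMonoid F
  exact Finset.sum_empty

theorem hsum_insert {ι : Type w} [DecidableEq ι] {s : Finset ι} {i : ι} (hi : i ∉ s)
    (x : ι → F) : hsum (insert i s) x = setAdd {x i} (hsum s x) := by
  let _ := setAddCommMonoid F
  exact Finset.sum_insert hi

end Hypersum

section Orthogonality

variable {F : Type u} [Hyperfield F] {E : Type v}

/-- An involution of the hyperfield `F`. -/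
structure IsInvolution (τ : F → F) : Prop where
  map_hadd : ∀ x y, τ '' hadd x y = hadd (τ x) (τ y)
  map_zero : τ 0 = 0
  map_one : τ 1 = 1
  map_mul : ∀ x y, τ (x * y) = τ x * τ y
  involutive : ∀ x, τ (τ x) = x

/-- `X ⊥ Y` with respect to `τ`: zero lies in the hypersum of the `X e * τ (Y e)`. -/
def Orthogonal [Fintype E] (τ : F → F) (X Y : E → F) : Prop :=
  (0 : F) ∈ hsum Finset.univ (fun e => X e * τ (Y e))

/-- `S^⊥`, the set of all elements of `F^E` orthogonal to every element of `S`. -/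
def orthogonalSet [Fintype E] (τ : F → F) (S : Set (E → F)) : Set (E → F) :=
  {X | ∀ Y ∈ S, Orthogonal τ X Y}

/-- The elements of `S` of minimal support. -/
def suppMin (S : Set (E → F)) : Set (E → F) :=
  {X | X ∈ S ∧ ∀ Y ∈ S, ¬ Function.support Y ⊂ Function.support X}

/-- The cocircuits of the matroid with circuit set `C`: the elements of minimal support of
`C^⊥ \ {0}`. -/
def cocircuits [Fintype E] (τ : F → F) (C : Set (E → F)) : Set (E → F) :=
  suppMin (orthogonalSet τ C \ {0})

end Orthogonality

section Modular

variable {E : Type v}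

/-- Two members `A`, `B` of a family `S` of subsets of `E` form a modular pair in `S`: they are
distinct and `A ∪ B` does not properly contain a union of two distinct members of `S`. -/
def IsModularPair (S : Set (Set E)) (A B : Set E) : Prop :=
  A ∈ S ∧ B ∈ S ∧ A ≠ B ∧
    ∀ A' ∈ S, ∀ B' ∈ S, A' ≠ B' → ¬ (A' ∪ B' ⊂ A ∪ B)

/-- The set of all unions of subfamilies of `S`, ordered by inclusion. It is a lattice whose joins
are unions. -/
def unions (S : Set (Set E)) : Set (Set E) := {A | ∃ T, T ⊆ S ∧ A = ⋃₀ T}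

theorem iUnion_mem_unions {S : Set (Set E)} {ι : Type w} {A : ι → Set E} (hA : ∀ i, A i ∈ S) :
    (⋃ i, A i) ∈ unions S :=
  ⟨Set.range A, by rintro _ ⟨i, rfl⟩; exact hA i, (Set.sUnion_range A).symm⟩

/-- A family of (pairwise distinct) members of `S` is modular if the height of its join in the
lattice of unions of members of `S` is the size of the family. -/
def IsModularFamily (S : Set (Set E)) {ι : Type w} [Fintype ι] (A : ι → Set E) : Prop :=
  Function.Injective A ∧
    ∃ hA : ∀ i, A i ∈ S,
      Order.height (⟨⋃ i, A i, iUnion_mem_unions hA⟩ : unions S) = (Fintype.card ι : ℕ∞)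

end Modular

section Matroids

variable {F : Type u} [Hyperfield F] {E : Type v}

/-- The family of supports of the elements of `C`. -/
def supports (C : Set (E → F)) : Set (Set E) := Function.support '' C

/-- The circuit axioms common to weak and strong matroids over `F`. -/
structure IsCircuitSignature (C : Set (E → F)) : Prop where
  zero_notMem : (0 : E → F) ∉ C
  smul_mem : ∀ X ∈ C, ∀ α : F, α ≠ 0 → (fun e => α * X e) ∈ C
  incomparable : ∀ X ∈ C, ∀ Y ∈ C, Function.support X ⊆ Function.support Y →
    ∃ α : F, α ≠ 0 ∧ X = fun e => α * Y e

/-- `C` is the `F`-circuit set of a weak `F`-matroid on `E`: modular elimination holds. -/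
structure IsWeakMatroid (C : Set (E → F)) : Prop extends IsCircuitSignature C where
  modular_elimination : ∀ X ∈ C, ∀ Y ∈ C,
    IsModularPair (supports C) (Function.support X) (Function.support Y) →
    ∀ e : E, X e = -Y e → X e ≠ 0 →
      ∃ Z ∈ C, Z e = 0 ∧ ∀ f, Z f ∈ hadd (X f) (Y f)

/-- `C` is the `F`-circuit set of a strong `F`-matroid on `E`: strong modular elimination holds. -/
structure IsStrongMatroid (C : Set (E → F)) : Prop extends IsCircuitSignature C where
  strong_modular_elimination : ∀ (k : ℕ) (X : E → F) (Y : Fin k → E → F),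
    X ∈ C → (∀ i, Y i ∈ C) →
    IsModularFamily (supports C)
      (Fin.cons (Function.support X) (fun i => Function.support (Y i)) : Fin (k + 1) → Set E) →
    ¬ Function.support X ⊆ ⋃ i, Function.support (Y i) →
    ∀ e : Fin k → E,
      (∀ i, e i ∈ (Function.support X ∩ Function.support (Y i)) \
        ⋃ j, ⋃ (_ : j ≠ i), Function.support (Y j)) →
      (∀ i, X (e i) = -Y i (e i)) →
      ∃ Z ∈ C, (∀ i, Z (e i) = 0) ∧
        ∀ f, Z f ∈ setAdd {X f} (hsum Finset.univ (fun i => Y i f))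

/-- The vectors of the matroid with circuit set `C`. -/
def IsVector [Fintype E] (τ : F → F) (C : Set (E → F)) (V : E → F) : Prop :=
  V ∈ orthogonalSet τ (cocircuits τ C)

/-- The covectors of the matroid with circuit set `C`. -/
def IsCovector [Fintype E] (τ : F → F) (C : Set (E → F)) (W : E → F) : Prop :=
  W ∈ orthogonalSet τ C

end Matroids

/-- The hyperfield `F` with involution `τ` is perfect: for every strong `F`-matroid on a finite set,
all vectors are orthogonal to all covectors. -/
def IsPerfect (F : Type u) [Hyperfield F] (τ : F → F) : Prop :=
  ∀ (E : Type) [Fintype E] (C : Set (E → F)), IsStrongMatroid C →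
    ∀ V W : E → F, IsVector τ C V → IsCovector τ C W → Orthogonal τ V W

end Hyperfield

/-! The supports of a weak `F`-matroid form a finite clutter with modular elimination, so they are
the circuits of an ordinary matroid `M` (`exists_matroid_of_modular`). For each hyperplane of `M`,
modular elimination yields a function `y`, nonzero exactly off the hyperplane, whose ratios are
forced by circuits meeting the complement in two elements (`exists_isFundamentalCocircuit`). A
circuit meeting that complement in at most three elements is always orthogonal to `y`
(`IsFundamentalCocircuit.perp_of_ncard_le_three`).

If all circuits are orthogonal to all such `y`, then (C3) holds
(`IsWeakMatroid.isStrongMatroid_of_perp`). The required `Z` is a scaled fundamental circuit, and its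
value at `f` is tested by a cocircuit that meets the union of the given supports only in `f`, in the
eliminated elements and in one element private to `X`.

Perfection supplies the missing orthogonality of `X` and `y` by induction on the size of `S = supp X
\ H`, where `y` vanishes on the hyperplane `H` (`IsPerfect.perp`). Contract an independent set of
corank two that contains `supp X ∩ H` and lies in `H`, then restrict to `S`. Circuits of this minor
have at most three elements, so the minor is strong. Its cocircuits come from hyperplanes containing
a further element of `S`, hence by induction `X` restricts to a vector, and `y` restricts to a
covector by the three-element case. Perfection makes the restrictions orthogonal, and no term of the
hypersum is lost in restricting. -/

namespace Hyperfield

/-! ### Arithmetic of hyperfields and hypersums. -/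

section Algebra

variable {F : Type u} [Hyperfield F]

theorem neg_mul' (x y : F) : -(x * y) = -x * y := by
  symm
  apply eq_neg_of_zero_mem
  have h := Set.mem_image_of_mem (fun t => y * t) (zero_mem_hadd_neg x)
  rw [mul_hadd] at h
  simpa [mul_comm] using h

theorem neg_neg' (x : F) : - -x = x := by
  symm
  apply eq_neg_of_zero_mem
  rw [hadd_comm]
  exact zero_mem_hadd_neg x

instance hasDistribNeg : HasDistribNeg F where
  neg_neg := neg_neg'
  neg_mul x y := (neg_mul' x y).symm
  mul_neg x y := by rw [mul_comm x (-y), ← neg_mul', mul_comm]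

theorem neg_zero' : -(0 : F) = 0 := by
  have h := neg_mul' (0 : F) 0
  rw [mul_zero, mul_zero] at h
  exact h

theorem zero_mem_hadd_iff {x y : F} : (0 : F) ∈ hadd x y ↔ x = -y := by
  constructor
  · intro h
    rw [hadd_comm] at h
    exact eq_neg_of_zero_mem _ _ h
  · rintro rfl
    rw [hadd_comm]
    exact zero_mem_hadd_neg y

theorem neg_eq_zero' {x : F} : -x = 0 ↔ x = 0 := by
  constructor
  · intro h
    rw [← neg_neg x, h, neg_zero']
  · rintro rfl
    exact neg_zero'

theorem mem_hadd_zero_iff {x y : F} : x ∈ hadd y 0 ↔ x = y := by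
  rw [hadd_comm, zero_hadd, Set.mem_singleton_iff]

theorem mem_zero_hadd_iff {x y : F} : x ∈ hadd 0 y ↔ x = y := by
  rw [zero_hadd, Set.mem_singleton_iff]

theorem mul_mem_hadd {a x y z : F} (h : x ∈ hadd y z) : a * x ∈ hadd (a * y) (a * z) := by
  rw [← mul_hadd]
  exact Set.mem_image_of_mem _ h

theorem mem_setAdd_singleton {a c : F} {B : Set F} :
    c ∈ setAdd {a} B ↔ ∃ b ∈ B, c ∈ hadd a b := by
  simp [setAdd]

/-- This moves one term of an orthogonality relation to the other side, turning it into the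
membership demanded by elimination. -/
theorem zero_mem_setAdd_neg_iff {z : F} {A : Set F} : (0 : F) ∈ setAdd {-z} A ↔ z ∈ A := by
  rw [mem_setAdd_singleton]
  constructor
  · rintro ⟨b, hb, h⟩
    rw [zero_mem_hadd_iff] at h
    rwa [neg_injective h]
  · intro h
    exact ⟨z, h, zero_mem_hadd_iff.2 rfl⟩

theorem image_setAdd {f : F → F} (h : ∀ x y, f '' hadd x y = hadd (f x) (f y))
    (A B : Set F) : f '' setAdd A B = setAdd (f '' A) (f '' B) := by
  ext c
  constructor
  · rintro ⟨d, ⟨a, ha, b, hb, hd⟩, rfl⟩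
    refine ⟨f a, ⟨a, ha, rfl⟩, f b, ⟨b, hb, rfl⟩, ?_⟩
    rw [← h]
    exact ⟨d, hd, rfl⟩
  · rintro ⟨_, ⟨a, ha, rfl⟩, _, ⟨b, hb, rfl⟩, hc⟩
    rw [← h] at hc
    obtain ⟨d, hd, rfl⟩ := hc
    exact ⟨d, ⟨a, ha, b, hb, hd⟩, rfl⟩

theorem image_hsum {f : F → F} (h : ∀ x y, f '' hadd x y = hadd (f x) (f y)) (h0 : f 0 = 0)
    {ι : Type w} (s : Finset ι) (x : ι → F) : f '' hsum s x = hsum s (fun i => f (x i)) := by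
  classical
  induction s using Finset.induction_on with
  | empty => simp [hsum_empty, h0]
  | insert i s hi ih =>
    rw [hsum_insert hi, hsum_insert hi, image_setAdd h, ih, Set.image_singleton]

theorem image_mul_hsum (a : F) {ι : Type w} (s : Finset ι) (x : ι → F) :
    (fun t => a * t) '' hsum s x = hsum s (fun i => a * x i) :=
  image_hsum (mul_hadd a) (mul_zero a) s x

theorem hsum_subset {ι : Type w} {s t : Finset ι} (h : s ⊆ t) {x : ι → F}
    (hx : ∀ i ∈ t, i ∉ s → x i = 0) : hsum s x = hsum t x := by
  let _ := setAddCommMonoid F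
  refine Finset.sum_subset h fun i hi his => ?_
  rw [hx i hi his]
  rfl

theorem hsum_map {ι : Type w} {κ : Type v} (s : Finset ι) (f : ι ↪ κ) (x : κ → F) :
    hsum (s.map f) x = hsum s (fun i => x (f i)) := by
  let _ := setAddCommMonoid F
  exact Finset.sum_map s f _

theorem hsum_congr {ι : Type w} {s : Finset ι} {x y : ι → F} (h : ∀ i ∈ s, x i = y i) :
    hsum s x = hsum s y := by
  let _ := setAddCommMonoid F
  exact Finset.sum_congr rfl fun i hi => by rw [h i hi]

theorem hsum_singleton {ι : Type w} (i : ι) (x : ι → F) : hsum {i} x = {x i} := by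
  let _ := setAddCommMonoid F
  exact Finset.sum_singleton _ i

theorem hsum_eq_zero {ι : Type w} {s : Finset ι} {x : ι → F} (h : ∀ i ∈ s, x i = 0) :
    hsum s x = {0} := by
  rw [← hsum_empty x]
  exact (hsum_subset (Finset.empty_subset s) fun i hi _ => h i hi).symm

theorem hsum_eq_single {ι : Type w} {s : Finset ι} {x : ι → F} (i : ι) (hi : i ∈ s)
    (h : ∀ j ∈ s, j ≠ i → x j = 0) : hsum s x = {x i} := by
  rw [← hsum_singleton i x]
  exact (hsum_subset (Finset.singleton_subset_iff.2 hi)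
    fun j hj hji => h j hj (by simpa using hji)).symm

end Algebra

/-! ### Bilinear orthogonality. -/

section Perp

variable {F : Type u} [Hyperfield F] {E : Type v} [Fintype E]

/-- Bilinear orthogonality: zero lies in the hypersum of the products `X e * y e`. -/
def Perp (X y : E → F) : Prop := (0 : F) ∈ hsum Finset.univ (fun e => X e * y e)

theorem perp_of_disjoint {X y : E → F} (h : ∀ e, X e * y e = 0) : Perp X y := by
  rw [Perp, hsum_eq_zero fun e _ => h e]
  rfl

theorem perp_iff_pair {X y : E → F} {a b : E} (hab : a ≠ b)
    (h : ∀ e, e ≠ a → e ≠ b → X e * y e = 0) : Perp X y ↔ X a * y a = -(X b * y b) := by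
  classical
  rw [Perp, ← hsum_subset (s := {a, b}) (Finset.subset_univ _), hsum_insert (by simpa using hab),
    hsum_singleton, mem_setAdd_singleton]
  · simp [zero_mem_hadd_iff]
  · intro e _ he
    simp only [Finset.mem_insert, Finset.mem_singleton, not_or] at he
    exact h e he.1 he.2

theorem perp_iff_triple {X y : E → F} {a b c : E} (hab : a ≠ b) (hac : a ≠ c) (hbc : b ≠ c)
    (h : ∀ e, e ≠ a → e ≠ b → e ≠ c → X e * y e = 0) :
    Perp X y ↔ -(X a * y a) ∈ hadd (X b * y b) (X c * y c) := by
  classical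
  rw [Perp, ← hsum_subset (s := {a, b, c}) (Finset.subset_univ _),
    hsum_insert (by simp [hab, hac]), hsum_insert (by simpa using hbc), hsum_singleton,
    ← neg_neg (X a * y a), zero_mem_setAdd_neg_iff, mem_setAdd_singleton, neg_neg]
  · simp
  · intro e _ he
    simp only [Finset.mem_insert, Finset.mem_singleton, not_or] at he
    exact h e he.1 he.2.1 he.2.2

theorem perp_smul_right {X y : E → F} {a : F} (h : Perp X y) : Perp X (fun e => a * y e) := by
  have h' := Set.mem_image_of_mem (fun t => a * t) h
  rw [image_mul_hsum] at h'
  simpa [Perp, mul_left_comm] using h'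

theorem perp_comp_iff {E' : Type w} [Fintype E'] (ι : E' ↪ E) {X y : E → F}
    (h : ∀ e, e ∉ Set.range ι → X e * y e = 0) :
    Perp (X ∘ ι) (y ∘ ι) ↔ Perp X y := by
  rw [Perp, Perp, ← hsum_subset (Finset.subset_univ (Finset.univ.map ι)), hsum_map]
  · rfl
  · intro e _ he
    exact h e (by simpa using he)

theorem orthogonal_iff_perp {τ : F → F} {X Y : E → F} :
    Orthogonal τ X Y ↔ Perp X (τ ∘ Y) := Iff.rfl

/-- Applying `τ` to a hypersum containing zero swaps the roles of the two arguments. Hence the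
involution can be absorbed into either one, and the rest of the argument can use the bilinear
relation. -/
theorem orthogonal_iff_perp_left {τ : F → F} (hτ : IsInvolution τ) {X Y : E → F} :
    Orthogonal τ X Y ↔ Perp Y (τ ∘ X) := by
  have key : ∀ X Y : E → F, Orthogonal τ X Y → Perp Y (τ ∘ X) := by
    intro X Y h
    have h' := Set.mem_image_of_mem τ h
    rw [image_hsum hτ.map_hadd hτ.map_zero, hτ.map_zero] at h'
    simpa [Perp, hτ.map_mul, hτ.involutive, mul_comm] using h'
  refine ⟨key X Y, fun h => ?_⟩
  have h' := key Y X h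
  exact h'

end Perp

/-! ### Clutters with modular elimination are matroids. -/

section Clutter

variable {E : Type v} [Finite E] {S : Set (Set E)}

/-- In a finite clutter, elimination for modular pairs implies elimination for all pairs. -/
theorem elimination_of_modular
    (hmod : ∀ A B, IsModularPair S A B → ∀ e ∈ A ∩ B, ∃ K ∈ S, K ⊆ (A ∪ B) \ {e})
    {A B : Set E} (hA : A ∈ S) (hB : B ∈ S) (hAB : A ≠ B) {e : E} (he : e ∈ A ∩ B) :
    ∃ K ∈ S, K ⊆ (A ∪ B) \ {e} := by
  induction h : (A ∪ B).ncard using Nat.strong_induction_on generalizing A B with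
  | _ n ih =>
    by_cases hm : IsModularPair S A B
    · exact hmod A B hm e he
    -- A non-modular pair has two distinct members with a strictly smaller union. If one of them
    -- misses `e` it already serves; otherwise induction applies to the new pair.
    · simp only [IsModularPair, not_and, not_forall, not_not] at hm
      obtain ⟨A', hA', B', hB', hne, hss⟩ := hm hA hB hAB
      have hlt := Set.ncard_lt_ncard hss (Set.toFinite _)
      by_cases heA : e ∈ A'
      · by_cases heB : e ∈ B'
        · obtain ⟨K, hK, hKs⟩ := ih _ (h ▸ hlt) hA' hB' hne ⟨heA, heB⟩ rfl
          exact ⟨K, hK, hKs.trans (Set.sdiff_subset_sdiff_left hss.subset)⟩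
        · exact ⟨B', hB', fun x hx => ⟨hss.subset (Or.inr hx), fun hxe => heB (hxe ▸ hx)⟩⟩
      · exact ⟨A', hA', fun x hx => ⟨hss.subset (Or.inl hx), fun hxe => heA (hxe ▸ hx)⟩⟩

/-- Augmentation for the sets containing no member of a family with circuit elimination. -/
theorem augmentation_of_elimination
    (helim : ∀ A ∈ S, ∀ B ∈ S, A ≠ B → ∀ e ∈ A ∩ B, ∃ K ∈ S, K ⊆ (A ∪ B) \ {e})
    {I J : Set E} (hI : ∀ K ∈ S, ¬ K ⊆ I) (hJ : ∀ K ∈ S, ¬ K ⊆ J) (hIJ : I.ncard < J.ncard) :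
    ∃ e ∈ J, e ∉ I ∧ ∀ K ∈ S, ¬ K ⊆ insert e I := by
  by_contra! hcon
  -- Among the sets in `I ∪ J` that contain no member of `S` and are larger than `I`, take one
  -- covering as much of `I` as possible.
  let P : Set E → Prop := fun L => L ⊆ I ∪ J ∧ (∀ K ∈ S, ¬ K ⊆ L) ∧ I.ncard < L.ncard
  obtain ⟨L, ⟨hLs, hL, hLc⟩, hmin⟩ : ∃ L, P L ∧ ∀ L', P L' → (I \ L).ncard ≤ (I \ L').ncard := by
    obtain ⟨L, hL, hmin⟩ := Set.exists_min_image {L | P L} (fun L => (I \ L).ncard)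
      (Set.toFinite _) ⟨J, Set.subset_union_right, hJ, hIJ⟩
    exact ⟨L, hL, hmin⟩
  obtain ⟨g, hgL, hgI⟩ := Set.exists_mem_notMem_of_ncard_lt_ncard hLc
  obtain ⟨e, heI, heL⟩ : ∃ e ∈ I, e ∉ L := by
    by_contra! hIL
    obtain ⟨K, hK, hKs⟩ := hcon g ((hLs hgL).resolve_left hgI) hgI
    exact hL K hK (hKs.trans (Set.insert_subset hgL hIL))
  -- Exchanging `f` for `e` keeps the size and covers more of `I`, so by the choice of `L` it must
  -- create a circuit through `e`.
  have key : ∀ f ∈ L, f ∉ I → ∃ K ∈ S, K ⊆ insert e L ∧ e ∈ K ∧ f ∉ K := by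
    intro f hfL hfI
    have hfe : f ≠ e := fun h => hfI (h ▸ heI)
    by_contra! hK
    have hT : P (insert e (L \ {f})) := by
      refine ⟨?_, fun K hKS hKs => ?_, ?_⟩
      · exact Set.insert_subset (Or.inl heI) (Set.sdiff_subset.trans hLs)
      · by_cases heK : e ∈ K
        · have hfK := hK K hKS (hKs.trans (Set.insert_subset_insert Set.sdiff_subset)) heK
          rcases hKs hfK with h | h
          · exact hfe h
          · exact h.2 rfl
        · refine hL K hKS fun x hx => ?_
          rcases hKs hx with h | h
          · exact absurd (h ▸ hx) heK
          · exact h.1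
      · rwa [Set.ncard_insert_of_notMem (fun h => heL h.1) (Set.toFinite _),
          Set.ncard_sdiff_singleton_add_one hfL (Set.toFinite _)]
    have hle := hmin _ hT
    refine absurd hle (not_le.2 (Set.ncard_lt_ncard ?_ (Set.toFinite _)))
    refine ⟨fun x hx => ⟨hx.1, fun hxL => hx.2 (Or.inr ⟨hxL, fun h => hfI (h ▸ hx.1)⟩)⟩, fun h => ?_⟩
    exact (h ⟨heI, heL⟩).2 (Or.inl rfl)
  obtain ⟨K, hK, hKs, heK, hgK⟩ := key g hgL hgI
  obtain ⟨x, hxK, hxL, hxI⟩ : ∃ x ∈ K, x ∈ L ∧ x ∉ I := by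
    by_contra! h
    refine hI K hK fun x hx => ?_
    rcases hKs hx with h' | h'
    · exact h' ▸ heI
    · exact h x hx h'
  obtain ⟨K', hK', hKs', heK', hxK'⟩ := key x hxL hxI
  obtain ⟨K'', hK'', hKs''⟩ := helim K hK K' hK' (fun h => hxK' (h ▸ hxK)) e ⟨heK, heK'⟩
  refine hL K'' hK'' fun z hz => ?_
  have hz' := hKs'' hz
  exact (Set.union_subset hKs hKs' hz'.1).resolve_left hz'.2

/-- A finite clutter of nonempty sets with modular elimination is the set of circuits of a
matroid. -/
theorem exists_matroid_of_modular (hne : ∅ ∉ S) (hanti : ∀ A ∈ S, ∀ B ∈ S, A ⊆ B → A = B)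
    (hmod : ∀ A B, IsModularPair S A B → ∀ e ∈ A ∩ B, ∃ K ∈ S, K ⊆ (A ∪ B) \ {e}) :
    ∃ M : Matroid E, M.E = Set.univ ∧ ∀ K, M.IsCircuit K ↔ K ∈ S := by
  let N : IndepMatroid E := IndepMatroid.ofFinite (E := Set.univ) Set.finite_univ
    (fun I => ∀ K ∈ S, ¬ K ⊆ I)
    (fun K hK h => hne (Set.subset_empty_iff.1 h ▸ hK))
    (fun I J hJ hIJ K hK hKI => hJ K hK (hKI.trans hIJ))
    (fun I J hI hJ hIJ => augmentation_of_elimination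
      (fun A hA B hB hAB e he => elimination_of_modular hmod hA hB hAB he) hI hJ hIJ)
    (fun I _ => Set.subset_univ I)
  refine ⟨N.matroid, rfl, fun K => ?_⟩
  have hind : ∀ I, N.matroid.Indep I ↔ ∀ K ∈ S, ¬ K ⊆ I := fun I => Iff.rfl
  rw [Matroid.isCircuit_iff_minimal_not_indep (Set.subset_univ K)]
  constructor
  · intro h
    have h1 := h.prop
    rw [hind] at h1
    push Not at h1
    obtain ⟨L, hL, hLK⟩ := h1
    have : L = K := h.eq_of_subset (fun h => (hind L).1 h L hL subset_rfl) hLK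
    exact this ▸ hL
  · intro hK
    refine ⟨fun h => (hind K).1 h K hK subset_rfl, fun L hL hLK => ?_⟩
    replace hL := mt (hind L).2 hL
    push Not at hL
    obtain ⟨L', hL', hLL'⟩ := hL
    have := hanti L' hL' K hK (hLL'.trans hLK)
    exact this ▸ hLL'

end Clutter

/-! ### Circuits, nullity and hyperplanes in ordinary matroids. -/

section MatroidFacts

variable {α : Type v} {M : Matroid α}

/-- Two distinct circuits inside an independent set plus two elements have no two distinct circuits
properly inside their union. -/
theorem not_union_ssubset_of_subset_insert_insert [Finite α] {I A B A' B' : Set α} {u v : α}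
    (hI : M.Indep I)
    (hA : M.IsCircuit A) (hB : M.IsCircuit B) (hAI : A ⊆ insert u (insert v I))
    (hBI : B ⊆ insert u (insert v I)) (hA' : M.IsCircuit A') (hB' : M.IsCircuit B')
    (hne : A' ≠ B') : ¬ A' ∪ B' ⊂ A ∪ B := by
  intro hss
  obtain ⟨x, hx, hx'⟩ := Set.exists_of_ssubset hss
  have hAB : A ∪ B ⊆ M.E := Set.union_subset hA.subset_ground hB.subset_ground
  obtain ⟨J, hJ⟩ := M.exists_isBasis ((A ∪ B) \ {x}) (Set.sdiff_subset.trans hAB)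
  -- The union of `A` and `B` has nullity at most two. Since `x` lies on a circuit inside it,
  -- deleting `x` keeps the rank and leaves nullity at most one, which allows only one circuit.
  have hxcl : x ∈ M.closure ((A ∪ B) \ {x}) := by
    rcases hx with hx | hx
    · exact M.closure_subset_closure (Set.sdiff_subset_sdiff_left Set.subset_union_left)
        (hA.mem_closure_sdiff_singleton_of_mem hx)
    · exact M.closure_subset_closure (Set.sdiff_subset_sdiff_left Set.subset_union_right)
        (hB.mem_closure_sdiff_singleton_of_mem hx)
  have hJ' : M.IsBasis J (A ∪ B) := by
    refine hJ.isBasis_of_closure_eq_closure (hJ.subset.trans Set.sdiff_subset) ?_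
    exact (M.closure_sdiff_singleton_eq_closure hxcl)
  obtain ⟨L, hL, hIL⟩ := (hI.inter_right (A ∪ B)).subset_isBasis_of_subset
    (Set.inter_subset_right) hAB
  have hLc : (A ∪ B).ncard ≤ L.ncard + 2 := by
    have hsub : A ∪ B ⊆ L ∪ {u, v} := by
      intro z hz
      rcases Set.union_subset hAI hBI hz with h | h | h
      · exact Or.inr (Or.inl h)
      · exact Or.inr (Or.inr h)
      · exact Or.inl (hIL ⟨h, hz⟩)
    refine (Set.ncard_le_ncard hsub (Set.toFinite _)).trans ((Set.ncard_union_le _ _).trans ?_)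
    have := Set.ncard_insert_le u {v}
    rw [Set.ncard_singleton] at this
    omega
  have hLJ : L.ncard = J.ncard := by
    rw [Set.ncard, Set.ncard, hL.encard_eq_encard hJ']
  have hx1 := Set.ncard_sdiff_singleton_add_one hx (Set.toFinite _)
  have hd := Set.ncard_sdiff_add_ncard_of_subset hJ.subset (Set.toFinite _)
  -- If the nullity is zero, any `w` will do; `x` is the default.
  obtain ⟨w, hw⟩ : ∃ w, ((A ∪ B) \ {x}) \ J ⊆ {w} := by
    rcases Nat.le_one_iff_eq_zero_or_eq_one.1 (show (((A ∪ B) \ {x}) \ J).ncard ≤ 1 by omega)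
      with h | h
    · rw [Set.ncard_eq_zero (Set.toFinite _)] at h
      exact ⟨x, h ▸ Set.empty_subset _⟩
    · obtain ⟨w, hw⟩ := Set.ncard_eq_one.1 h
      exact ⟨w, hw.subset⟩
  have hsub : ∀ K, K ⊆ A' ∪ B' → K ⊆ insert w J := by
    intro K hK z hz
    by_cases hzJ : z ∈ J
    · exact Or.inr hzJ
    · exact Or.inl (hw ⟨⟨hss.subset (hK hz), fun h => hx' (h ▸ hK hz)⟩, hzJ⟩)
  exact hne ((hA'.eq_fundCircuit_of_subset hJ.indep (hsub _ Set.subset_union_left)).trans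
    (hB'.eq_fundCircuit_of_subset hJ.indep (hsub _ Set.subset_union_right)).symm)

/-- An independent set whose closure is a hyperplane. -/
def IsHyperplaneBase (M : Matroid α) (A : Set α) : Prop :=
  M.Indep A ∧ ∃ e, e ∉ M.closure A ∧ M.IsBase (insert e A)

theorem IsHyperplaneBase.isBase_insert {A : Set α} (hA : IsHyperplaneBase M A) {e : α}
    (heE : e ∈ M.E) (he : e ∉ M.closure A) : M.IsBase (insert e A) := by
  obtain ⟨hAi, f, hf, hB⟩ := hA
  have hcl : M.closure (insert e A) = M.closure (insert f A) :=
    M.closure_insert_congr ⟨by rw [hB.closure_eq]; exact heE, he⟩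
  rw [Matroid.isBase_iff_indep_closure_eq, hcl, hB.closure_eq]
  exact ⟨hAi.insert_indep_iff.2 (Or.inl ⟨heE, he⟩), rfl⟩

theorem IsHyperplaneBase.exists_isCircuit {A : Set α} (hA : IsHyperplaneBase M A) {e f : α}
    (heE : e ∈ M.E) (hfE : f ∈ M.E) (he : e ∉ M.closure A) (hf : f ∉ M.closure A) (hef : e ≠ f) :
    ∃ K, M.IsCircuit K ∧ K ⊆ insert e (insert f A) := by
  refine ⟨_, (hA.isBase_insert hfE hf).fundCircuit_isCircuit heE ?_,
    M.fundCircuit_subset_insert e _⟩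
  rintro (h | h)
  · exact hef h
  · exact he (M.mem_closure_of_mem h hA.1.subset_ground)

theorem mem_of_isCircuit_subset_insert {K I : Set α} {e : α} (hK : M.IsCircuit K)
    (hI : M.Indep I) (hKI : K ⊆ insert e I) : e ∈ K := by
  by_contra he
  exact hK.not_indep (hI.subset fun x hx => (hKI hx).resolve_left fun h => he (h ▸ hx))

theorem eq_of_isCircuit_subset_insert {K K' I : Set α} {e : α} (hK : M.IsCircuit K)
    (hK' : M.IsCircuit K') (hI : M.Indep I) (hKI : K ⊆ insert e I) (hKI' : K' ⊆ insert e I) :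
    K = K' :=
  (hK.eq_fundCircuit_of_subset hI hKI).trans (hK'.eq_fundCircuit_of_subset hI hKI').symm

/-- A circuit meets the complement of a flat in no singleton. -/
theorem mem_closure_of_isCircuit_subset_insert {K A : Set α} {e : α} (hK : M.IsCircuit K)
    (heK : e ∈ K) (hKA : K ⊆ insert e (M.closure A)) : e ∈ M.closure A := by
  have h := hK.mem_closure_sdiff_singleton_of_mem heK
  have hs : K \ {e} ⊆ M.closure A := fun x hx => (hKA hx.1).resolve_left hx.2
  have := M.closure_subset_closure hs h
  rwa [M.closure_closure] at this

end MatroidFacts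

/-! ### The underlying matroid and its fundamental cocircuits. -/

section WeakDuality

variable {F : Type u} [Hyperfield F] {E : Type v} {C : Set (E → F)} {M : Matroid E}

/-- `M` is the matroid on `E` whose circuits are the supports of the members of `C`. -/
structure IsUnderlyingMatroid (M : Matroid E) (C : Set (E → F)) : Prop where
  ground : M.E = Set.univ
  isCircuit_iff : ∀ K, M.IsCircuit K ↔ K ∈ supports C

theorem IsUnderlyingMatroid.isCircuit (hM : IsUnderlyingMatroid M C) {X : E → F} (hX : X ∈ C) :
    M.IsCircuit (Function.support X) :=
  (hM.isCircuit_iff _).2 ⟨X, hX, rfl⟩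

theorem IsUnderlyingMatroid.exists_of_isCircuit (hM : IsUnderlyingMatroid M C) {K : Set E}
    (hK : M.IsCircuit K) : ∃ X ∈ C, Function.support X = K :=
  (hM.isCircuit_iff _).1 hK

theorem IsUnderlyingMatroid.mem_ground (hM : IsUnderlyingMatroid M C) (e : E) : e ∈ M.E :=
  hM.ground ▸ Set.mem_univ e

theorem IsUnderlyingMatroid.subset_ground (hM : IsUnderlyingMatroid M C) (A : Set E) : A ⊆ M.E :=
  hM.ground ▸ Set.subset_univ A

theorem support_smul {a : F} (ha : a ≠ 0) (X : E → F) :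
    Function.support (fun e => a * X e) = Function.support X := by
  ext e
  simp [ha]

theorem support_subset_of_mem_hadd {X Y Z : E → F} (h : ∀ f, Z f ∈ hadd (X f) (Y f)) :
    Function.support Z ⊆ Function.support X ∪ Function.support Y := by
  intro f hf
  by_contra hcon
  simp only [Set.mem_union, Function.mem_support, not_or, not_not] at hcon
  have hz := h f
  rw [hcon.1, hcon.2, mem_hadd_zero_iff] at hz
  exact hf hz

/-- Rescaling one of two circuits makes their values at a common element opposite, so modular
elimination of signatures passes to supports. -/
theorem IsWeakMatroid.exists_isUnderlyingMatroid [Finite E] (hC : IsWeakMatroid C) :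
    ∃ M : Matroid E, IsUnderlyingMatroid M C := by
  refine (exists_matroid_of_modular (S := supports C) ?_ ?_ ?_).imp fun M h => ⟨h.1, h.2⟩
  · rintro ⟨X, hX, h⟩
    rw [Function.support_eq_empty_iff] at h
    exact hC.zero_notMem (h ▸ hX)
  · rintro _ ⟨X, hX, rfl⟩ _ ⟨Y, hY, rfl⟩ h
    obtain ⟨a, ha, rfl⟩ := hC.incomparable X hX Y hY h
    exact support_smul ha Y
  · intro A B hAB e he
    obtain ⟨⟨X, hX, rfl⟩, ⟨Y, hY, rfl⟩, -⟩ := id hAB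
    have hXe : X e ≠ 0 := he.1
    have hYe : Y e ≠ 0 := he.2
    have ha : -(X e / Y e) ≠ 0 := by
      rw [Ne, neg_eq_zero']
      exact div_ne_zero hXe hYe
    obtain ⟨Z, hZ, hZe, hZs⟩ := hC.modular_elimination X hX _ (hC.smul_mem Y hY _ ha)
      (by rwa [support_smul ha]) e (by rw [neg_mul, neg_neg, div_mul_cancel₀ _ hYe]) hXe
    refine ⟨_, ⟨Z, hZ, rfl⟩, fun f hf => ⟨?_, fun h => hf (h ▸ hZe)⟩⟩
    have := support_subset_of_mem_hadd hZs hf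
    rwa [support_smul ha] at this

theorem IsCircuitSignature.exists_smul_of_subset_insert (hC : IsCircuitSignature C)
    (hM : IsUnderlyingMatroid M C) {I : Set E} (hI : M.Indep I) {X X' : E → F} (hX : X ∈ C)
    (hX' : X' ∈ C) {e : E} (hXI : Function.support X ⊆ insert e I)
    (hXI' : Function.support X' ⊆ insert e I) : ∃ a : F, a ≠ 0 ∧ X = fun e => a * X' e :=
  hC.incomparable X hX X' hX' (eq_of_isCircuit_subset_insert (hM.isCircuit hX) (hM.isCircuit hX')
    hI hXI hXI').subset

/-- Elimination between two circuits inside an independent set plus two elements. -/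
theorem IsWeakMatroid.eliminate [Finite E] (hC : IsWeakMatroid C) (hM : IsUnderlyingMatroid M C)
    {I : Set E} (hI : M.Indep I) {X X' : E → F} (hX : X ∈ C) (hX' : X' ∈ C) {u v : E}
    (hXI : Function.support X ⊆ insert u (insert v I))
    (hXI' : Function.support X' ⊆ insert u (insert v I))
    (hne : Function.support X ≠ Function.support X') {a : E} (ha : X a ≠ 0) (ha' : X' a ≠ 0) :
    ∃ c : F, c ≠ 0 ∧ X a = -(c * X' a) ∧
      ∃ Z ∈ C, Z a = 0 ∧ ∀ f, Z f ∈ hadd (X f) (c * X' f) := by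
  have hc : -(X a / X' a) ≠ 0 := by
    rw [Ne, neg_eq_zero']
    exact div_ne_zero ha ha'
  have hXa : X a = -(-(X a / X' a) * X' a) := by rw [neg_mul, neg_neg, div_mul_cancel₀ _ ha']
  refine ⟨_, hc, hXa, hC.modular_elimination X hX _ (hC.smul_mem X' hX' _ hc) ?_ a hXa ha⟩
  rw [support_smul hc]
  refine ⟨⟨X, hX, rfl⟩, ⟨X', hX', rfl⟩, hne, fun A hA B hB hAB => ?_⟩
  exact not_union_ssubset_of_subset_insert_insert hI (hM.isCircuit hX) (hM.isCircuit hX') hXI hXI'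
    ((hM.isCircuit_iff A).2 hA) ((hM.isCircuit_iff B).2 hB) hAB

/-- `y` vanishes exactly on the closure of `A` and is orthogonal to the circuits inside `A` plus
two elements outside the closure of `A`. -/
structure IsFundamentalCocircuit (M : Matroid E) (C : Set (E → F)) (A : Set E) (y : E → F) :
    Prop where
  eq_zero_iff : ∀ e, y e = 0 ↔ e ∈ M.closure A
  balanced : ∀ e f, e ≠ f → e ∉ M.closure A → f ∉ M.closure A → ∀ X ∈ C,
    Function.support X ⊆ insert e (insert f A) → X e * y e = -(X f * y f)

/-- Normalise `y` to be 1 at one point `e₀` off the hyperplane and read off its other values from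
the circuits through `e₀`. The relation for a pair avoiding `e₀` follows by eliminating `e₀` between
two of these circuits. -/
theorem exists_isFundamentalCocircuit [Finite E] (hC : IsWeakMatroid C)
    (hM : IsUnderlyingMatroid M C) {A : Set E} (hA : IsHyperplaneBase M A) :
    ∃ y : E → F, IsFundamentalCocircuit M C A y := by
  classical
  obtain ⟨e₀, he₀, hB⟩ := hA.2
  have hcirc : ∀ f, f ∉ M.closure A → f ≠ e₀ →
      ∃ X ∈ C, Function.support X ⊆ insert e₀ (insert f A) ∧ X e₀ ≠ 0 ∧ X f ≠ 0 := by
    intro f hf hfe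
    obtain ⟨K, hK, hKs⟩ := hA.exists_isCircuit (hM.mem_ground e₀) (hM.mem_ground f) he₀ hf hfe.symm
    obtain ⟨X, hX, rfl⟩ := hM.exists_of_isCircuit hK
    refine ⟨X, hX, hKs, ?_, ?_⟩
    · exact mem_of_isCircuit_subset_insert hK (hA.isBase_insert (hM.mem_ground f) hf).indep hKs
    · exact mem_of_isCircuit_subset_insert hK hB.indep (by rwa [Set.insert_comm])
  choose! G hGC hGs hG₀ hGf using hcirc
  let y : E → F := fun f => if f ∈ M.closure A then 0 else if f = e₀ then 1
    else -(G f e₀ / G f f)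
  have hy₀ : y e₀ = 1 := by simp [y, he₀]
  have hyf : ∀ f, f ∉ M.closure A → f ≠ e₀ → y f = -(G f e₀ / G f f) := by
    intro f hf hfe
    simp [y, hf, hfe]
  have hG : ∀ f, f ∉ M.closure A → f ≠ e₀ → G f e₀ = -(G f f * y f) := by
    intro f hf hfe
    rw [hyf f hf hfe, mul_neg, neg_neg, mul_div_cancel₀ _ (hGf f hf hfe)]
  have hbase : ∀ f, f ∉ M.closure A → f ≠ e₀ → ∀ X ∈ C,
      Function.support X ⊆ insert e₀ (insert f A) → X e₀ * y e₀ = -(X f * y f) := by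
    intro f hf hfe X hX hXs
    obtain ⟨a, ha, rfl⟩ := hC.exists_smul_of_subset_insert hM
      (hA.isBase_insert (hM.mem_ground f) hf).indep hX (hGC f hf hfe) hXs (hGs f hf hfe)
    rw [hy₀, mul_one, mul_assoc, ← mul_neg, ← hG f hf hfe]
  refine ⟨y, fun e => ⟨fun h => ?_, fun h => by simp [y, h]⟩, ?_⟩
  · by_contra he
    by_cases hee : e = e₀
    · rw [hee, hy₀] at h
      exact one_ne_zero h
    · rw [hyf e he hee, neg_eq_zero'] at h
      exact div_ne_zero (hG₀ e he hee) (hGf e he hee) h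
  · intro e f hef he hf X hX hXs
    by_cases hee : e = e₀
    · subst hee
      exact hbase f hf hef.symm X hX hXs
    by_cases hfe : f = e₀
    · subst hfe
      rw [hbase e he hef X hX (by rwa [Set.insert_comm]), neg_neg]
    have hGe0 : G e f = 0 := by
      by_contra h
      rcases hGs e he hee h with h' | h' | h'
      · exact hfe h'
      · exact hef h'.symm
      · exact hf (M.mem_closure_of_mem h' (hM.subset_ground A))
    have hGf0 : G f e = 0 := by
      by_contra h
      rcases hGs f hf hfe h with h' | h' | h'
      · exact hee h'
      · exact hef h'
      · exact he (M.mem_closure_of_mem h' (hM.subset_ground A))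
    -- `G e` vanishes at `f` and `G f` vanishes at `e`, so the hypersums at `e` and `f` are single
    -- elements and `Z` is known there.
    obtain ⟨c, hc, hce, Z, hZ, hZ0, hZs⟩ := hC.eliminate hM hB.indep (hGC e he hee) (hGC f hf hfe)
      (u := e) (v := f) (a := e₀)
      ((hGs e he hee).trans (by intro z; simp only [Set.mem_insert_iff]; tauto))
      ((hGs f hf hfe).trans (by intro z; simp only [Set.mem_insert_iff]; tauto))
      (fun h => by
        have : e ∈ Function.support (G f) := h ▸ hGf e he hee
        exact this hGf0)
      (hG₀ e he hee) (hG₀ f hf hfe)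
    have hZe : Z e = G e e := by
      have := hZs e
      rwa [hGf0, mul_zero, mem_hadd_zero_iff] at this
    have hZf : Z f = c * G f f := by
      have := hZs f
      rwa [hGe0, mem_zero_hadd_iff] at this
    have hZsub : Function.support Z ⊆ insert e (insert f A) := by
      intro z hz
      have hz0 : z ≠ e₀ := fun h => hz (h ▸ hZ0)
      rcases support_subset_of_mem_hadd hZs hz with h | h
      · rcases hGs e he hee h with h | h | h
        · exact absurd h hz0
        · exact Or.inl h
        · exact Or.inr (Or.inr h)
      · rw [support_smul hc] at h
        rcases hGs f hf hfe h with h | h | h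
        · exact absurd h hz0
        · exact Or.inr (Or.inl h)
        · exact Or.inr (Or.inr h)
    obtain ⟨a, ha, rfl⟩ := hC.exists_smul_of_subset_insert hM
      (hA.isBase_insert (hM.mem_ground f) hf).indep hX hZ hXs hZsub
    simp only [hZe, hZf]
    have h1 := hG e he hee
    have h2 := hG f hf hfe
    have h3 : G e e * y e = -(c * (G f f * y f)) := by
      have h4 : -(G e e * y e) = c * (G f f * y f) := by
        rw [← h1, hce, h2, mul_neg, neg_neg]
      rw [← h4, neg_neg]
    rw [mul_assoc, h3, mul_neg, mul_assoc, mul_assoc]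

/-- A circuit testing `y` against the old set can be changed into one for the new set by eliminating
`a` with `K`. As `K` lives in the hyperplane, the two values paired with `y` do not change. -/
theorem IsFundamentalCocircuit.exchange [Finite E] (hC : IsWeakMatroid C)
    (hM : IsUnderlyingMatroid M C) {A : Set E} (hA : IsHyperplaneBase M A) {y : E → F}
    (hy : IsFundamentalCocircuit M C A y) {K : E → F} (hK : K ∈ C) {a b : E}
    (hKa : K a ≠ 0) (hKb : K b ≠ 0)
    (hKs : Function.support K ⊆ insert b A) :
    IsHyperplaneBase M (insert b A \ {a}) ∧ M.closure (insert b A \ {a}) = M.closure A ∧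
      IsFundamentalCocircuit M C (insert b A \ {a}) y := by
  have hbcl : b ∈ M.closure A :=
    M.closure_subset_closure (fun z hz => (hKs hz.1).resolve_left hz.2)
      ((hM.isCircuit hK).mem_closure_sdiff_singleton_of_mem hKb)
  have hacl : a ∈ M.closure (insert b A \ {a}) :=
    M.closure_subset_closure (Set.sdiff_subset_sdiff_left hKs)
      ((hM.isCircuit hK).mem_closure_sdiff_singleton_of_mem hKa)
  have hcl : M.closure (insert b A \ {a}) = M.closure A := by
    rw [M.closure_sdiff_singleton_eq_closure hacl, M.closure_insert_eq_of_mem_closure hbcl]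
  have hind : M.Indep (insert b A \ {a}) := by
    rw [M.indep_iff_forall_subset_not_isCircuit (hM.subset_ground _)]
    intro L hL hLc
    have := eq_of_isCircuit_subset_insert hLc (hM.isCircuit hK) hA.1 (hL.trans Set.sdiff_subset) hKs
    have haL : a ∈ L := this ▸ hKa
    exact (hL haL).2 rfl
  have hA' : IsHyperplaneBase M (insert b A \ {a}) := by
    obtain ⟨e, he, hB⟩ := hA.2
    refine ⟨hind, e, hcl ▸ he, ?_⟩
    rw [Matroid.isBase_iff_indep_closure_eq, M.closure_insert_congr_right hcl, hB.closure_eq]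
    exact ⟨hind.insert_indep_iff.2 (Or.inl ⟨hM.mem_ground e, hcl ▸ he⟩), rfl⟩
  refine ⟨hA', hcl, fun e => by rw [hcl, hy.eq_zero_iff], ?_⟩
  intro e f hef he hf X hX hXs
  obtain ⟨K₀, hK₀, hK₀s⟩ := hA.exists_isCircuit (hM.mem_ground e) (hM.mem_ground f)
    (hcl ▸ he) (hcl ▸ hf) hef
  obtain ⟨G, hG, rfl⟩ := hM.exists_of_isCircuit hK₀
  have hGy := hy.balanced e f hef (hcl ▸ he) (hcl ▸ hf) G hG hK₀s
  obtain ⟨Z, hZ, hZs, hZe, hZf⟩ : ∃ Z ∈ C,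
      Function.support Z ⊆ insert e (insert f (insert b A \ {a})) ∧ Z e = G e ∧ Z f = G f := by
    by_cases hGa : G a = 0
    · refine ⟨G, hG, fun z hz => ?_, rfl, rfl⟩
      rcases hK₀s hz with h | h | h
      · exact Or.inl h
      · exact Or.inr (Or.inl h)
      · exact Or.inr (Or.inr ⟨Or.inr h, fun h' => hz (h' ▸ hGa)⟩)
    · have hK0 : ∀ z, z ∉ M.closure A → K z = 0 := by
        intro z hz
        by_contra hzK
        rcases hKs hzK with h | h
        · exact hz (h ▸ hbcl)
        · exact hz (M.mem_closure_of_mem h (hM.subset_ground A))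
      have hGe : G e ≠ 0 := mem_of_isCircuit_subset_insert hK₀
        (hA.isBase_insert (hM.mem_ground f) (hcl ▸ hf)).indep hK₀s
      obtain ⟨c, hc, hca, Z, hZ, hZ0, hZs⟩ := hC.eliminate hM
        (hA.isBase_insert (hM.mem_ground e) (hcl ▸ he)).indep hG hK (u := f) (v := b) (a := a)
        (hK₀s.trans (by intro z; simp only [Set.mem_insert_iff]; tauto))
        (hKs.trans (by intro z; simp only [Set.mem_insert_iff]; tauto))
        (fun h => by
          have : e ∈ Function.support K := h ▸ hGe
          exact this (hK0 e (hcl ▸ he)))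
        hGa hKa
      refine ⟨Z, hZ, fun z hz => ?_, ?_, ?_⟩
      · have hza : z ≠ a := fun h => hz (h ▸ hZ0)
        rcases support_subset_of_mem_hadd hZs hz with h | h
        · rcases hK₀s h with h | h | h
          · exact Or.inl h
          · exact Or.inr (Or.inl h)
          · exact Or.inr (Or.inr ⟨Or.inr h, hza⟩)
        · rw [support_smul hc] at h
          exact Or.inr (Or.inr ⟨hKs h, hza⟩)
      · have := hZs e
        rwa [hK0 e (hcl ▸ he), mul_zero, mem_hadd_zero_iff] at this
      · have := hZs f
        rwa [hK0 f (hcl ▸ hf), mul_zero, mem_hadd_zero_iff] at this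
  obtain ⟨c, hc, rfl⟩ := hC.exists_smul_of_subset_insert hM
    (hA'.isBase_insert (hM.mem_ground f) hf).indep hX hZ hXs hZs
  simp only [hZe, hZf]
  rw [mul_assoc, hGy, mul_neg, mul_assoc]

/-- The relation does not depend on the chosen basis of the hyperplane: exchanges bring that basis
towards `X` until `X` lies in it together with `e` and `f`. -/
theorem IsFundamentalCocircuit.balanced_of_subset_closure [Finite E] (hC : IsWeakMatroid C)
    (hM : IsUnderlyingMatroid M C) {y X : E → F} (hX : X ∈ C) {e f : E} (hef : e ≠ f)
    {A : Set E} (hA : IsHyperplaneBase M A) (hy : IsFundamentalCocircuit M C A y)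
    (he : e ∉ M.closure A) (hf : f ∉ M.closure A)
    (hXs : Function.support X ⊆ insert e (insert f (M.closure A))) :
    X e * y e = -(X f * y f) := by
  induction hn : (Function.support X \ A).ncard using Nat.strong_induction_on generalizing A with
  | _ n ih =>
    by_cases hXA : Function.support X ⊆ insert e (insert f A)
    · exact hy.balanced e f hef he hf X hX hXA
    by_cases hXef : X e = 0 ∧ X f = 0
    · rw [hXef.1, hXef.2, zero_mul, zero_mul, neg_zero']
    obtain ⟨b, hXb, hb⟩ := Set.not_subset.1 hXA
    simp only [Set.mem_insert_iff, not_or] at hb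
    obtain ⟨hbe, hbf, hbA⟩ := hb
    have hbcl : b ∈ M.closure A := ((hXs hXb).resolve_left hbe).resolve_left hbf
    have hKc := hA.1.fundCircuit_isCircuit hbcl hbA
    have hKb := M.mem_fundCircuit b A
    have hKs := M.fundCircuit_subset_insert b A
    obtain ⟨K, hK, hKeq⟩ := hM.exists_of_isCircuit hKc
    rw [← hKeq] at hKc hKb hKs
    have hKcl : Function.support K ⊆ M.closure A := fun z hz => (hKs hz).elim (fun h => h ▸ hbcl)
      fun h => M.mem_closure_of_mem h (hM.subset_ground A)
    -- Otherwise the two circuits coincide and `X` lies in the hyperplane, making both of its values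
    -- at `e` and `f` zero.
    obtain ⟨a, haK, haX⟩ : ∃ a ∈ Function.support K, a ∉ Function.support X := by
      by_contra! hKX
      have hXK := hKc.eq_of_subset_isCircuit (hM.isCircuit hX) hKX
      rw [hXK] at hKcl
      refine hXef ⟨?_, ?_⟩
      · by_contra h
        exact he (hKcl h)
      · by_contra h
        exact hf (hKcl h)
    have hab : a ≠ b := fun h => haX (h ▸ hXb)
    have haA : a ∈ A := (hKs haK).resolve_left hab
    obtain ⟨hA', hcl, hy'⟩ := hy.exchange hC hM hA hK haK hKb hKs
    refine ih _ ?_ hA' hy' (hcl ▸ he) (hcl ▸ hf) (hcl ▸ hXs) rfl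
    rw [← hn]
    refine Set.ncard_lt_ncard ⟨fun z hz => ⟨hz.1, fun hzA => hz.2 ⟨Or.inr hzA, ?_⟩⟩, fun h => ?_⟩
      (Set.toFinite _)
    · exact fun h => haX (h ▸ hz.1)
    · exact (h ⟨hXb, hbA⟩).2 ⟨Or.inl rfl, hab.symm⟩

/-- Circuits meeting a fundamental cocircuit in at most three elements are orthogonal to it. -/
theorem IsFundamentalCocircuit.perp_of_ncard_le_three [Fintype E] (hC : IsWeakMatroid C)
    (hM : IsUnderlyingMatroid M C) {y X : E → F} (hX : X ∈ C) {A : Set E}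
    (hA : IsHyperplaneBase M A) (hy : IsFundamentalCocircuit M C A y)
    (h3 : (Function.support X \ M.closure A).ncard ≤ 3) : Perp X y := by
  set D := Function.support X \ M.closure A with hD
  have hzero : ∀ e, e ∉ D → X e * y e = 0 := by
    intro e he
    by_cases hXe : X e = 0
    · rw [hXe, zero_mul]
    · rw [(hy.eq_zero_iff e).2 (by_contra fun h => he ⟨hXe, h⟩), mul_zero]
  have hsub : Function.support X ⊆ M.closure A ∪ D := fun z hz => by
    by_cases h : z ∈ M.closure A
    · exact Or.inl h
    · exact Or.inr ⟨hz, h⟩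
  have h0123 : D.ncard = 0 ∨ D.ncard = 1 ∨ D.ncard = 2 ∨ D.ncard = 3 := by omega
  rcases h0123 with h | h | h | h
  · rw [Set.ncard_eq_zero (Set.toFinite _)] at h
    exact perp_of_disjoint fun e => hzero e (h ▸ Set.notMem_empty e)
  · obtain ⟨e, he⟩ := Set.ncard_eq_one.1 h
    have heD : e ∈ D := he ▸ rfl
    exfalso
    refine heD.2 (mem_closure_of_isCircuit_subset_insert (hM.isCircuit hX) heD.1 fun z hz => ?_)
    rcases hsub hz with h | h
    · exact Or.inr h
    · rw [he] at h
      exact Or.inl h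
  · obtain ⟨e, f, hef, hD'⟩ := Set.ncard_eq_two.1 h
    have heD : e ∈ D := by simp [hD']
    have hfD : f ∈ D := by simp [hD']
    rw [perp_iff_pair hef fun g hge hgf => hzero g (by simp [hD', hge, hgf])]
    refine hy.balanced_of_subset_closure hC hM hX hef hA heD.2 hfD.2 fun z hz => ?_
    rcases hsub hz with h | h
    · exact Or.inr (Or.inr h)
    · rw [hD'] at h
      exact h.imp_right Or.inl
  · obtain ⟨e, f, g, hef, heg, hfg, hD'⟩ := Set.ncard_eq_three.1 h
    have heD : e ∈ D := by simp [hD']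
    have hfD : f ∈ D := by simp [hD']
    have hgD : g ∈ D := by simp [hD']
    rw [perp_iff_triple hef heg hfg fun z hze hzf hzg => hzero z (by simp [hD', hze, hzf, hzg])]
    have hcl : Function.support X \ D ⊆ M.closure A := fun z hz => (hsub hz.1).resolve_right hz.2
    -- Part of `X` inside the hyperplane is a proper subset of a circuit, hence independent, and
    -- extends to a basis `B` of the hyperplane. Now `X` lies in `B` plus three elements.
    obtain ⟨B, hB, hXB⟩ := ((hM.isCircuit hX).ssubset_indep (X := Function.support X \ D)
      ⟨Set.sdiff_subset, fun h => (h heD.1).2 heD⟩).subset_isBasis_of_subset hcl (hM.subset_ground _)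
    have hBcl : M.closure B = M.closure A := by rw [hB.closure_eq_closure, M.closure_closure]
    have hBh : IsHyperplaneBase M B := by
      obtain ⟨e, he, hAe⟩ := hA.2
      refine ⟨hB.indep, e, hBcl ▸ he, ?_⟩
      rw [Matroid.isBase_iff_indep_closure_eq, M.closure_insert_congr_right hBcl, hAe.closure_eq]
      exact ⟨hB.indep.insert_indep_iff.2 (Or.inl ⟨hM.mem_ground e, hBcl ▸ he⟩), rfl⟩
    have hBA : B ⊆ M.closure A := hB.subset
    have hXB' : Function.support X ⊆ insert f (insert g (insert e B)) := by
      intro z hz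
      by_cases hzD : z ∈ D
      · rw [hD'] at hzD
        simp only [Set.mem_insert_iff, Set.mem_singleton_iff] at hzD ⊢
        tauto
      · exact Or.inr (Or.inr (Or.inr (hXB ⟨hz, hzD⟩)))
    have hecl : e ∉ M.closure B := hBcl ▸ heD.2
    have hfcl : f ∉ M.closure B := hBcl ▸ hfD.2
    obtain ⟨K, hK, hKs⟩ := hBh.exists_isCircuit (hM.mem_ground e) (hM.mem_ground f) hecl hfcl hef
    obtain ⟨G, hG, rfl⟩ := hM.exists_of_isCircuit hK
    have hGe : G e ≠ 0 := mem_of_isCircuit_subset_insert hK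
      (hBh.isBase_insert (hM.mem_ground f) hfcl).indep hKs
    have hGg : G g = 0 := by
      by_contra h
      rcases hKs h with h | h | h
      · exact heg h.symm
      · exact hfg h.symm
      · exact hgD.2 (hBA h)
    -- Eliminating `e` between `X` and `G` leaves a circuit with only `f` and `g` off the
    -- hyperplane. The two-term relations for `G` and `Z` turn the membership at `f` into the
    -- three-term relation for `X`.
    obtain ⟨c, hc, hce, Z, hZ, hZe, hZs⟩ := hC.eliminate hM
      (hBh.isBase_insert (hM.mem_ground e) hecl).indep hX hG (u := f) (v := g) (a := e) hXB'
      (hKs.trans (by intro z; simp only [Set.mem_insert_iff]; tauto))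
      (fun h => by
        have : g ∈ Function.support G := h ▸ hgD.1
        exact this hGg)
      heD.1 hGe
    have hGbal : G e * y e = -(G f * y f) := by
      refine hy.balanced_of_subset_closure hC hM hG hef hA heD.2 hfD.2 (hKs.trans ?_)
      exact Set.insert_subset_insert (Set.insert_subset_insert hBA)
    have hZbal : Z f * y f = -(Z g * y g) := by
      refine hy.balanced_of_subset_closure hC hM hZ hfg hA hfD.2 hgD.2 fun z hz => ?_
      have hze : z ≠ e := fun h => hz (h ▸ hZe)
      have : z ∈ insert f (insert g (insert e B)) := by
        rcases support_subset_of_mem_hadd hZs hz with h | h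
        · exact hXB' h
        · rw [support_smul hc] at h
          have := hKs h
          simp only [Set.mem_insert_iff] at this ⊢
          tauto
      rcases this with h | h | h | h
      · exact Or.inl h
      · exact Or.inr (Or.inl h)
      · exact absurd h hze
      · exact Or.inr (Or.inr (hBA h))
    have hZg : Z g = X g := by
      have := hZs g
      rwa [hGg, mul_zero, mem_hadd_zero_iff] at this
    have hXe : X e * y e = y f * (c * G f) := by
      rw [hce, neg_mul, mul_assoc, hGbal, mul_neg, neg_neg, mul_comm (y f), mul_assoc]
    have h1 := mul_mem_hadd (a := y f) (hZs f)
    rw [← hXe, mul_comm (y f), mul_comm (y f), hZbal, hZg, mem_hadd_iff] at h1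
    have h2 := mul_mem_hadd (a := -1) h1
    simp only [neg_mul, one_mul, neg_neg] at h2
    rwa [hadd_comm]

end WeakDuality

/-! ### Strong elimination from orthogonality. -/

section StrongElimination

/-- In a modular family, deleting one private element of each member from the union leaves no
member of `S`. -/
theorem not_subset_of_isModularFamily {E : Type v} {S : Set (Set E)} {k : ℕ} {X : Set E}
    {Y : Fin k → Set E} (hmod : IsModularFamily S (Fin.cons X Y : Fin (k + 1) → Set E))
    {e : Fin k → E} (he : ∀ i, e i ∈ Y i) (hne : ∀ i j, j ≠ i → e i ∉ Y j) {g : E} (hgX : g ∈ X)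
    (hgY : ∀ i, g ∉ Y i) {K : Set E} (hK : K ∈ S) (hK0 : K.Nonempty) (heK : ∀ i, e i ∉ K)
    (hgK : g ∉ K) : ¬ K ⊆ X ∪ ⋃ i, Y i := by
  intro hKU
  obtain ⟨-, hS, hht⟩ := hmod
  have hYS : ∀ i, Y i ∈ S := fun i => by simpa using hS i.succ
  have hU : ∀ z, z ∈ (⋃ i, (Fin.cons X Y : Fin (k + 1) → Set E) i) ↔ z ∈ X ∪ ⋃ i, Y i := by
    intro z
    simp
  -- The chain starts at `K` and adjoins the `Y i` one at a time. It is strict because `e j` is new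
  -- at step `j`; with the empty union below and the full union, which contains `g`, on top, it
  -- would give height at least `k + 2`.
  let W : ℕ → unions S := fun j => ⟨_, insert K {B | ∃ i : Fin k, i.val < j ∧ B = Y i}, by
    rintro B (rfl | ⟨i, -, rfl⟩)
    · exact hK
    · exact hYS i, rfl⟩
  have hW : ∀ j z, z ∈ (W j).1 ↔ z ∈ K ∨ ∃ i : Fin k, i.val < j ∧ z ∈ Y i := by
    intro j z
    simp only [W, Set.mem_sUnion, Set.mem_insert_iff, Set.mem_ofPred_eq]
    constructor
    · rintro ⟨B, rfl | ⟨i, hi, rfl⟩, hz⟩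
      · exact Or.inl hz
      · exact Or.inr ⟨i, hi, hz⟩
    · rintro (hz | ⟨i, hi, hz⟩)
      · exact ⟨K, Or.inl rfl, hz⟩
      · exact ⟨Y i, Or.inr ⟨i, hi, rfl⟩, hz⟩
  have hheight : ∀ j ≤ k, ((j + 1 : ℕ) : ℕ∞) ≤ Order.height (W j) := by
    intro j
    induction j with
    | zero =>
      intro _
      have hlt : (⟨∅, ∅, Set.empty_subset _, Set.sUnion_empty.symm⟩ : unions S) < W 0 := by
        obtain ⟨z, hz⟩ := hK0
        exact ⟨Set.empty_subset _, fun h => h ((hW 0 z).2 (Or.inl hz))⟩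
      have := Order.height_add_one_le hlt
      exact le_trans (by simp) this
    | succ j ih =>
      intro hj
      have hlt : W j < W (j + 1) := by
        refine ⟨fun z hz => ?_, fun h => ?_⟩
        · rw [hW] at hz ⊢
          exact hz.imp_right fun ⟨i, hi, hz⟩ => ⟨i, by omega, hz⟩
        · have h1 := h ((hW _ (e ⟨j, hj⟩)).2 (Or.inr ⟨⟨j, hj⟩, Nat.lt_succ_self j, he _⟩))
          rcases (hW _ _).1 h1 with h2 | ⟨i, hi, h2⟩
          · exact heK _ h2
          · exact hne ⟨j, hj⟩ i (fun h => by simp [h] at hi) h2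
      refine le_trans ?_ (Order.height_add_one_le hlt)
      push_cast
      exact add_le_add_left (by exact_mod_cast ih (by omega)) 1
  have hlt : W k < ⟨_, iUnion_mem_unions hS⟩ := by
    refine ⟨fun z hz => ?_, fun h => ?_⟩
    · rw [hU]
      rcases (hW _ _).1 hz with h | ⟨i, -, h⟩
      · exact hKU h
      · exact Or.inr (Set.mem_iUnion.2 ⟨i, h⟩)
    · rcases (hW _ _).1 (h ((hU g).2 (Or.inl hgX))) with h | ⟨i, -, h⟩
      · exact hgK h
      · exact hgY i h
  have h1 := (add_le_add_left (hheight k le_rfl) 1).trans (Order.height_add_one_le hlt)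
  rw [hht, Fintype.card_fin] at h1
  have h2 : k + 1 + 1 ≤ k + 1 := by exact_mod_cast h1
  omega

variable {F : Type u} [Hyperfield F] {E : Type v} {C : Set (E → F)} {M : Matroid E}

/-- A weak matroid all of whose circuits are orthogonal to all fundamental cocircuits is strong. -/
theorem IsWeakMatroid.isStrongMatroid_of_perp [Fintype E] (hC : IsWeakMatroid C)
    (hM : IsUnderlyingMatroid M C)
    (hperp : ∀ A y, IsHyperplaneBase M A → IsFundamentalCocircuit M C A y → ∀ X ∈ C, Perp X y) :
    IsStrongMatroid C := by
  classical
  refine ⟨hC.toIsCircuitSignature, fun k X Y hX hY hmod hXY e he heq => ?_⟩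
  obtain ⟨g, hgX, hgY⟩ := Set.not_subset.1 hXY
  have hgY' : ∀ i, Y i g = 0 := fun i => by
    by_contra h
    exact hgY (Set.mem_iUnion.2 ⟨i, h⟩)
  have heX : ∀ i, X (e i) ≠ 0 := fun i => (he i).1.1
  have heY : ∀ i, Y i (e i) ≠ 0 := fun i => (he i).1.2
  have heY' : ∀ i j, j ≠ i → Y j (e i) = 0 := fun i j hji => by
    by_contra h
    exact (he i).2 (Set.mem_iUnion₂.2 ⟨j, hji, h⟩)
  have heg : ∀ i, e i ≠ g := fun i h => heY i (h ▸ hgY' i)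
  have hinj : Function.Injective e := fun i j hij => by
    by_contra h
    exact heY i (hij ▸ heY' j i h)
  let U : Set E := Function.support X ∪ ⋃ i, Function.support (Y i)
  -- This set is independent by modularity and spans `U`. So a circuit in `U` avoiding every `e i`
  -- must be the fundamental circuit of `g`.
  let B₀ : Set E := U \ insert g (Set.range e)
  have hB₀ : M.Indep B₀ := by
    rw [M.indep_iff_forall_subset_not_isCircuit (hM.subset_ground _)]
    intro K hKB hK
    refine not_subset_of_isModularFamily hmod (e := e) (g := g) heY
      (fun i j hji h => h (heY' i j hji)) hgX (fun i h => h (hgY' i)) ((hM.isCircuit_iff K).1 hK)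
      hK.nonempty (fun i h => ?_) (fun h => ?_) (hKB.trans Set.sdiff_subset)
    · exact (hKB h).2 (Or.inr ⟨i, rfl⟩)
    · exact (hKB h).2 (Or.inl rfl)
  have hgB₀ : g ∉ B₀ := fun h => h.2 (Or.inl rfl)
  have hecl : ∀ i, e i ∈ M.closure B₀ := by
    intro i
    refine M.closure_subset_closure ?_
      ((hM.isCircuit (hY i)).mem_closure_sdiff_singleton_of_mem (heY i))
    rintro z ⟨hz, hze⟩
    refine ⟨Or.inr (Set.mem_iUnion.2 ⟨i, hz⟩), ?_⟩
    rintro (rfl | ⟨j, rfl⟩)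
    · exact hz (hgY' i)
    · exact hz (heY' j i fun h => hze (h ▸ rfl))
  have hgcl : g ∈ M.closure B₀ := by
    have h := (hM.isCircuit hX).mem_closure_sdiff_singleton_of_mem hgX
    have hs : Function.support X \ {g} ⊆ M.closure B₀ := by
      rintro z ⟨hz, hzg⟩
      by_cases hze : z ∈ Set.range e
      · obtain ⟨i, rfl⟩ := hze
        exact hecl i
      · refine M.mem_closure_of_mem ⟨Or.inl hz, ?_⟩ (hM.subset_ground _)
        rintro (h | h)
        · exact hzg h
        · exact hze h
    have := M.closure_subset_closure hs h
    rwa [M.closure_closure] at this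
  have hKc := hB₀.fundCircuit_isCircuit hgcl hgB₀
  have hKg := M.mem_fundCircuit g B₀
  have hKs := M.fundCircuit_subset_insert g B₀
  obtain ⟨Z₀, hZ₀, hZeq⟩ := hM.exists_of_isCircuit hKc
  rw [← hZeq] at hKc hKg hKs
  have ha : X g / Z₀ g ≠ 0 := div_ne_zero hgX hKg
  obtain ⟨Z, hZ, hZg, hZs⟩ : ∃ Z ∈ C, Z g = X g ∧ Function.support Z ⊆ insert g B₀ :=
    ⟨_, hC.smul_mem Z₀ hZ₀ _ ha, div_mul_cancel₀ _ hKg, by rwa [support_smul ha]⟩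
  have hZe : ∀ i, Z (e i) = 0 := by
    intro i
    by_contra h
    rcases hZs h with h | h
    · exact heg i h
    · exact h.2 (Or.inr ⟨i, rfl⟩)
  refine ⟨Z, hZ, hZe, fun f => ?_⟩
  by_cases hfe : f ∈ Set.range e
  · obtain ⟨i, rfl⟩ := hfe
    rw [hsum_eq_single i (Finset.mem_univ i) fun j _ hji => heY' i j hji, hZe,
      mem_setAdd_singleton]
    exact ⟨_, rfl, zero_mem_hadd_iff.2 (heq i)⟩
  by_cases hfg : f = g
  · subst hfg
    rw [hsum_eq_zero fun i _ => hgY' i, mem_setAdd_singleton]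
    exact ⟨0, rfl, mem_hadd_zero_iff.2 hZg⟩
  by_cases hfU : f ∉ U
  · have hX0 : X f = 0 := by
      by_contra h
      exact hfU (Or.inl h)
    have hY0 : ∀ i, Y i f = 0 := fun i => by
      by_contra h
      exact hfU (Or.inr (Set.mem_iUnion.2 ⟨i, h⟩))
    have hZ0 : Z f = 0 := by
      by_contra h
      rcases hZs h with h | h
      · exact hfg h
      · exact hfU h.1
    rw [hsum_eq_zero fun i _ => hY0 i, mem_setAdd_singleton]
    exact ⟨0, rfl, mem_hadd_zero_iff.2 (hZ0.trans hX0.symm)⟩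
  have hfB₀ : f ∈ B₀ := ⟨not_not.1 hfU, by rintro (h | h) <;> contradiction⟩
  -- The hyperplane spanned by `B \ {f}` contains all of `B₀` except `f`. Its cocircuit therefore
  -- meets `U` only in `f`, `g` and the `e i`.
  obtain ⟨B, hB, hB₀B⟩ := hB₀.exists_isBase_superset
  have hA : IsHyperplaneBase M (B \ {f}) := by
    refine ⟨hB.indep.sdiff _, f, hB.indep.notMem_closure_sdiff_of_mem (hB₀B hfB₀), ?_⟩
    rwa [Set.insert_sdiff_singleton, Set.insert_eq_of_mem (hB₀B hfB₀)]
  obtain ⟨y, hy⟩ := exists_isFundamentalCocircuit hC hM hA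
  have hyf : y f ≠ 0 := by
    rw [Ne, hy.eq_zero_iff]
    exact hB.indep.notMem_closure_sdiff_of_mem (hB₀B hfB₀)
  have hyB₀ : ∀ z ∈ B₀, z ≠ f → y z = 0 := by
    intro z hz hzf
    rw [hy.eq_zero_iff]
    exact M.mem_closure_of_mem ⟨hB₀B hz, hzf⟩ (hM.subset_ground _)
  have hZy : X g * y g = -(Z f * y f) := by
    rw [← hZg]
    refine (perp_iff_pair (Ne.symm hfg) fun z hzg hzf => ?_).1 (hperp _ y hA hy Z hZ)
    by_cases hz : Z z = 0
    · rw [hz, zero_mul]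
    · rw [hyB₀ z ((hZs hz).resolve_left hzg) hzf, mul_zero]
  have hYy : ∀ i, y f * Y i f = X (e i) * y (e i) := by
    intro i
    rw [heq i, neg_mul, mul_comm]
    refine (perp_iff_pair (fun h => hfe ⟨i, h.symm⟩) fun z hzf hze => ?_).1
      (hperp _ y hA hy (Y i) (hY i))
    by_cases hz : Y i z = 0
    · rw [hz, zero_mul]
    · rw [hyB₀ z ⟨Or.inr (Set.mem_iUnion.2 ⟨i, hz⟩), ?_⟩ hzf, mul_zero]
      rintro (rfl | ⟨j, rfl⟩)
      · exact hz (hgY' i)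
      · exact hz (heY' j i fun h => hze (h ▸ rfl))
  have hXy := hperp _ y hA hy X hX
  have hs : hsum (insert f (insert g (Finset.univ.map ⟨e, hinj⟩))) (fun z => X z * y z)
      = hsum Finset.univ (fun z => X z * y z) := by
    refine hsum_subset (Finset.subset_univ _) fun z _ hz => ?_
    simp only [Finset.mem_insert, Finset.mem_map, Finset.mem_univ, true_and,
      Function.Embedding.coeFn_mk, not_or] at hz
    by_cases hXz : X z = 0
    · rw [hXz, zero_mul]
    · rw [hyB₀ z ⟨Or.inl hXz, ?_⟩ hz.1, mul_zero]
      rintro (h | h)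
      · exact hz.2.1 h
      · exact hz.2.2 h
  -- In the relation for `X`, the term at `g` becomes `-(Z f * y f)` and each term at `e i` becomes
  -- `y f * Y i f`. Cancelling `y f` leaves the desired membership.
  rw [Perp, ← hs, hsum_insert, hsum_insert, hsum_map] at hXy
  · simp only [Function.Embedding.coeFn_mk] at hXy
    rw [← setAdd_assoc, setAdd_comm {X f * y f}, setAdd_assoc, hZy, zero_mem_setAdd_neg_iff] at hXy
    rw [hsum_congr fun i _ => (hYy i).symm, ← image_mul_hsum, mul_comm (X f), mul_comm (Z f),
      ← Set.image_singleton (f := fun t => y f * t), ← image_setAdd (mul_hadd (y f))] at hXy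
    obtain ⟨t, ht, hte⟩ := hXy
    rwa [← mul_left_cancel₀ hyf hte]
  · simpa using heg
  · simp only [Finset.mem_insert, Finset.mem_map, Finset.mem_univ, true_and,
      Function.Embedding.coeFn_mk, not_or]
    exact ⟨hfg, hfe⟩

end StrongElimination

/-! ### Minors of weak matroids. -/

section Minor

variable {F : Type u} [Hyperfield F] {E : Type v} {E' : Type w} {C : Set (E → F)} {M : Matroid E}
  {A : Set E} {ι : E' ↪ E}

/-- The signature of the minor obtained by contracting `A` and restricting to the range of `ι`:
the restrictions of minimal support of the members of `C` supported in `A ∪ range ι`. -/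
def minor (C : Set (E → F)) (A : Set E) (ι : E' ↪ E) : Set (E' → F) :=
  {Z | ∃ X ∈ C, Function.support X ⊆ A ∪ Set.range ι ∧ Z = X ∘ ι ∧
    ∀ X' ∈ C, Function.support X' ⊆ A ∪ Set.range ι →
      Function.support (X' ∘ ι) ⊆ Function.support (X ∘ ι) →
      Function.support (X' ∘ ι) = Function.support (X ∘ ι)}

theorem support_subset_of_comp {X : E → F} (hX : Function.support X ⊆ A ∪ Set.range ι) {T : Set E'}
    (hT : Function.support (X ∘ ι) ⊆ T) : Function.support X ⊆ A ∪ ι '' T := by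
  intro z hz
  rcases hX hz with h | ⟨t, rfl⟩
  · exact Or.inl h
  · exact Or.inr ⟨t, hT hz, rfl⟩

theorem exists_mem_minor [Finite E'] {X : E → F} (hX : X ∈ C)
    (hXs : Function.support X ⊆ A ∪ Set.range ι) :
    ∃ Z ∈ minor C A ι, Function.support Z ⊆ Function.support (X ∘ ι) := by
  induction hn : (Function.support (X ∘ ι)).ncard using Nat.strong_induction_on generalizing X with
  | _ n ih =>
    by_cases h : ∀ X' ∈ C, Function.support X' ⊆ A ∪ Set.range ι →
      Function.support (X' ∘ ι) ⊆ Function.support (X ∘ ι) →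
      Function.support (X' ∘ ι) = Function.support (X ∘ ι)
    · exact ⟨X ∘ ι, ⟨X, hX, hXs, rfl, h⟩, subset_rfl⟩
    · push Not at h
      obtain ⟨X', hX', hXs', hsub, hne⟩ := h
      obtain ⟨Z, hZ, hZs⟩ := ih _
        (hn ▸ Set.ncard_lt_ncard (hsub.ssubset_of_ne hne) (Set.toFinite _)) hX' hXs' rfl
      exact ⟨Z, hZ, hZs.trans hsub⟩

theorem support_comp_subset (hdisj : ∀ z, ι z ∉ A) {X : E → F} {T : Set E'}
    (hX : Function.support X ⊆ A ∪ ι '' T) : Function.support (X ∘ ι) ⊆ T := by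
  intro z hz
  rcases hX hz with h | ⟨t, ht, htz⟩
  · exact absurd h (hdisj z)
  · exact ι.injective htz ▸ ht

/-- A circuit of `M` inside this set would restrict to something containing a circuit of the minor.
-/
theorem IsUnderlyingMatroid.indep_union_image [Finite E'] (hM : IsUnderlyingMatroid M C)
    (hdisj : ∀ z, ι z ∉ A) {T : Set E'} (hT : ∀ Z ∈ minor C A ι, ¬ Function.support Z ⊆ T) : M.Indep (A ∪ ι '' T) := by
  rw [M.indep_iff_forall_subset_not_isCircuit (hM.subset_ground _)]
  intro K hK hKc
  obtain ⟨X, hX, rfl⟩ := hM.exists_of_isCircuit hKc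
  obtain ⟨Z, hZ, hZs⟩ := exists_mem_minor hX
    (hK.trans (Set.union_subset_union_right A (Set.image_subset_range ι T)))
  exact hT Z hZ (hZs.trans (support_comp_subset hdisj hK))

theorem minor_eq_of_subset {Z Z' : E' → F} (hZ : Z ∈ minor C A ι) (hZ' : Z' ∈ minor C A ι)
    (h : Function.support Z ⊆ Function.support Z') : Function.support Z = Function.support Z' := by
  obtain ⟨X, hX, hXs, rfl, -⟩ := hZ
  obtain ⟨X', hX', hXs', rfl, hmin⟩ := hZ'
  exact hmin X hX hXs h

/-- An independent set plus one element contains at most one circuit, so minimality of the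
restricted support is automatic. -/
theorem mem_minor_of_subset_insert (hM : IsUnderlyingMatroid M C) {I : Set E} {e : E}
    (hdisj : ∀ z, ι z ∉ A) {T : Set E'} (hI : M.Indep I) (hTI : A ∪ ι '' T ⊆ insert e I)
    {X : E → F} (hX : X ∈ C) (hXT : Function.support X ⊆ A ∪ ι '' T) : X ∘ ι ∈ minor C A ι := by
  refine ⟨X, hX, hXT.trans (Set.union_subset_union_right A (Set.image_subset_range ι T)), rfl,
    fun X' hX' hXs' hsub => ?_⟩
  have hXT' := support_subset_of_comp hXs' (hsub.trans (support_comp_subset hdisj hXT))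
  have := eq_of_isCircuit_subset_insert (hM.isCircuit hX') (hM.isCircuit hX) hI
    (hXT'.trans hTI) (hXT.trans hTI)
  ext z
  exact Set.ext_iff.1 this (ι z)

/-- Each axiom is lifted to `C`: minimality or modularity in the minor places the lifted circuits in
an independent set plus one or two elements, where uniqueness or elimination is available. -/
theorem IsWeakMatroid.minor [Finite E] [Finite E'] (hC : IsWeakMatroid C)
    (hM : IsUnderlyingMatroid M C) (hA : M.Indep A) (hdisj : ∀ z, ι z ∉ A) :
    IsWeakMatroid (minor C A ι) := by
  have hne : (0 : E' → F) ∉ Hyperfield.minor C A ι := by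
    rintro ⟨X, hX, hXs, h0, -⟩
    have := support_subset_of_comp hXs (T := ∅) (by rw [← h0]; simp)
    rw [Set.image_empty, Set.union_empty] at this
    exact (hM.isCircuit hX).not_indep (hA.subset this)
  refine ⟨⟨hne, ?_, ?_⟩, ?_⟩
  · rintro _ ⟨X, hX, hXs, rfl, hmin⟩ a ha
    refine ⟨_, hC.smul_mem X hX a ha, by rwa [support_smul ha], rfl, ?_⟩
    have : Function.support ((fun e => a * X e) ∘ ι) = Function.support (X ∘ ι) :=
      support_smul ha (X ∘ ι)
    rwa [this]
  · intro Z hZ Z' hZ' hsub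
    have heq := minor_eq_of_subset hZ hZ' hsub
    obtain ⟨t, ht⟩ : (Function.support Z').Nonempty := by
      rw [Set.nonempty_iff_ne_empty, Ne, Function.support_eq_empty_iff]
      exact fun h => hne (h ▸ hZ')
    have hind : M.Indep (A ∪ ι '' (Function.support Z' \ {t})) := by
      refine hM.indep_union_image hdisj fun Z'' hZ'' hs => ?_
      have := minor_eq_of_subset hZ'' hZ' (hs.trans Set.sdiff_subset)
      exact (hs (this ▸ ht)).2 rfl
    have hins : ∀ X : E → F, Function.support X ⊆ A ∪ ι '' Function.support Z' →
        Function.support X ⊆ insert (ι t) (A ∪ ι '' (Function.support Z' \ {t})) := by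
      intro X hX z hz
      rcases hX hz with h | ⟨s, hs, rfl⟩
      · exact Or.inr (Or.inl h)
      · by_cases hst : s = t
        · exact Or.inl (hst ▸ rfl)
        · exact Or.inr (Or.inr ⟨s, ⟨hs, hst⟩, rfl⟩)
    obtain ⟨X, hX, hXs, rfl, -⟩ := hZ
    obtain ⟨X', hX', hXs', hZeq, -⟩ := hZ'
    obtain ⟨a, ha, rfl⟩ := hC.exists_smul_of_subset_insert hM hind hX hX'
      (hins X (support_subset_of_comp hXs hsub))
      (hins X' (support_subset_of_comp hXs' (by rw [hZeq])))
    exact ⟨a, ha, by rw [hZeq]; rfl⟩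
  · intro Z hZ Z' hZ' hmod e heq he
    obtain ⟨-, -, hTne, hmod⟩ := hmod
    have he' : Z' e ≠ 0 := fun h => he (by rw [heq, h, neg_zero'])
    obtain ⟨u, huZ, huZ'⟩ := Set.not_subset.1 fun h => hTne (minor_eq_of_subset hZ hZ' h)
    have hind : M.Indep
        (A ∪ ι '' ((Function.support Z ∪ Function.support Z') \ {u, e})) := by
      refine hM.indep_union_image hdisj fun Z'' hZ'' hs => ?_
      -- A circuit avoiding `u` and `e` would form, with `Z'`, a pair whose union misses `u`,
      -- against modularity.
      refine hmod _ ⟨Z'', hZ'', rfl⟩ _ ⟨Z', hZ', rfl⟩ (fun h => ?_) ⟨?_, fun h => ?_⟩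
      · exact (hs (h ▸ he' : e ∈ Function.support Z'')).2 (Or.inr rfl)
      · exact Set.union_subset (hs.trans Set.sdiff_subset) Set.subset_union_right
      · rcases h (Or.inl huZ) with h | h
        · exact (hs h).2 (Or.inl rfl)
        · exact huZ' h
    have hins : ∀ X : E → F,
        Function.support X ⊆ A ∪ ι '' (Function.support Z ∪ Function.support Z') →
        Function.support X ⊆ insert (ι e) (insert (ι u)
          (A ∪ ι '' ((Function.support Z ∪ Function.support Z') \ {u, e}))) := by
      intro X hX z hz
      rcases hX hz with h | ⟨s, hs, rfl⟩
      · exact Or.inr (Or.inr (Or.inl h))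
      · by_cases hse : s = e
        · exact Or.inl (hse ▸ rfl)
        · by_cases hsu : s = u
          · exact Or.inr (Or.inl (hsu ▸ rfl))
          · exact Or.inr (Or.inr (Or.inr ⟨s, ⟨hs, by simp [hse, hsu]⟩, rfl⟩))
    obtain ⟨X, hX, hXs, rfl, -⟩ := hZ
    obtain ⟨X', hX', hXs', rfl, -⟩ := hZ'
    have hXT := support_subset_of_comp hXs
      (Set.subset_union_left (t := Function.support (X' ∘ ι)))
    have hXT' := support_subset_of_comp hXs'
      (Set.subset_union_right (s := Function.support (X ∘ ι)))
    obtain ⟨c, hc, hce, W, hW, hWe, hWs⟩ := hC.eliminate hM hind hX hX' (hins X hXT) (hins X' hXT')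
      (fun h => huZ' (h ▸ huZ : ι u ∈ Function.support X')) he he'
    -- The values at `e` are already opposite, so no rescaling took place.
    obtain rfl : c = 1 := by
      have h : X (ι e) = -X' (ι e) := heq
      rw [h] at hce
      exact (mul_eq_right₀ he').1 (neg_injective hce).symm
    simp only [one_mul] at hWs
    refine ⟨W ∘ ι, ?_, hWe, fun f => hWs (ι f)⟩
    have hWT := (support_subset_of_mem_hadd hWs).trans (Set.union_subset hXT hXT')
    refine mem_minor_of_subset_insert hM hdisj (e := ι u)
      (T := (Function.support (X ∘ ι) ∪ Function.support (X' ∘ ι)) \ {e}) hind ?_ hW ?_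
    · rintro z (h | ⟨s, hs, rfl⟩)
      · exact Or.inr (Or.inl h)
      · by_cases hsu : s = u
        · exact Or.inl (hsu ▸ rfl)
        · refine Or.inr (Or.inr ⟨s, ⟨hs.1, ?_⟩, rfl⟩)
          rintro (h | h)
          · exact hsu h
          · exact hs.2 h
    · intro z hz
      rcases hWT hz with h | ⟨s, hs, rfl⟩
      · exact Or.inl h
      · exact Or.inr ⟨s, ⟨hs, fun h => hz (h ▸ hWe)⟩, rfl⟩

/-- A circuit of the minor with one element removed is independent over `A`, and `A` has corank two.
-/
theorem ncard_support_le_three [Finite E] [Finite E'] (hM : IsUnderlyingMatroid M C)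
    (hdisj : ∀ z, ι z ∉ A) {p q : E} (hB : M.IsBase (insert p (insert q A)))
    {Z : E' → F} (hZ : Z ∈ minor C A ι) : (Function.support Z).ncard ≤ 3 := by
  rcases (Function.support Z).eq_empty_or_nonempty with h | ⟨t, ht⟩
  · simp [h]
  have hind : M.Indep (A ∪ ι '' (Function.support Z \ {t})) := by
    refine hM.indep_union_image hdisj fun Z' hZ' hs => ?_
    have := minor_eq_of_subset hZ' hZ (hs.trans Set.sdiff_subset)
    exact (hs (this ▸ ht)).2 rfl
  obtain ⟨B, hBb, hAB⟩ := hind.exists_isBase_superset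
  have h1 := Set.ncard_le_ncard hAB (Set.toFinite _)
  rw [hBb.ncard_eq_ncard_of_isBase hB, Set.ncard_union_eq ?_ (Set.toFinite _) (Set.toFinite _),
    Set.ncard_image_of_injective _ ι.injective] at h1
  · have h2 := Set.ncard_insert_le p (insert q A)
    have h3 := Set.ncard_insert_le q A
    have h4 := Set.ncard_sdiff_singleton_add_one ht (Set.toFinite _)
    omega
  · rw [Set.disjoint_left]
    rintro _ h ⟨s, -, rfl⟩
    exact hdisj s h

end Minor

/-! ### Cocircuits of rank-two minors. -/

section RankTwoMinor

variable {F : Type u} [Hyperfield F] {E : Type v} {E' : Type w} {C : Set (E → F)} {M : Matroid E}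
  {A : Set E} {ι : E' ↪ E}

/-- If `s` lies in the span of `A` and `q`, it may replace `q`, and `p` completes the base;
otherwise `q` does. -/
theorem isHyperplaneBase_insert {α : Type v} {M : Matroid α} {A : Set α} {p q s : α}
    (hB : M.IsBase (insert p (insert q A))) (hpq : p ≠ q) (hp : p ∉ A) (hq : q ∉ A) (hs : s ∈ M.E)
    (hsA : s ∉ M.closure A) : IsHyperplaneBase M (insert s A) := by
  have hqA : M.Indep (insert q A) := hB.indep.subset (Set.subset_insert _ _)
  have hA : M.Indep A := hqA.subset (Set.subset_insert _ _)
  have hpE : p ∈ M.E := hB.subset_ground (Or.inl rfl)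
  have hpcl : p ∉ M.closure (insert q A) := by
    refine (hqA.insert_indep_iff_of_notMem ?_).1 hB.indep |>.2
    rintro (h | h)
    · exact hpq h
    · exact hp h
  have hqh : IsHyperplaneBase M (insert q A) := ⟨hqA, p, hpcl, hB⟩
  have hsi : M.Indep (insert s A) := hA.insert_indep_iff.2 (Or.inl ⟨hs, hsA⟩)
  by_cases hsq : s ∈ M.closure (insert q A)
  · have hcl : M.closure (insert s A) = M.closure (insert q A) :=
      M.closure_insert_congr ⟨hsq, hsA⟩
    refine ⟨hsi, p, hcl ▸ hpcl, ?_⟩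
    rw [Matroid.isBase_iff_indep_closure_eq, M.closure_insert_congr_right hcl, hB.closure_eq]
    exact ⟨hsi.insert_indep_iff.2 (Or.inl ⟨hpE, hcl ▸ hpcl⟩), rfl⟩
  · have hb := hqh.isBase_insert hs hsq
    rw [Set.insert_comm] at hb
    refine ⟨hsi, q, ?_, hb⟩
    refine (hsi.insert_indep_iff_of_notMem ?_).1 hb.indep |>.2
    rintro (rfl | h)
    · exact hsq (M.mem_closure_of_mem (Or.inl rfl) hqA.subset_ground)
    · exact hq h

theorem perp_comp_iff_of_subset [Fintype E] [Fintype E'] {X y : E → F}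
    (hX : Function.support X ⊆ A ∪ Set.range ι) (hy : ∀ e ∈ A, y e = 0) :
    Perp (X ∘ ι) (y ∘ ι) ↔ Perp X y := by
  refine perp_comp_iff ι fun e he => ?_
  by_cases hXe : X e = 0
  · rw [hXe, zero_mul]
  · rw [hy e ((hX hXe).resolve_right he), mul_zero]

variable [Fintype E] [Fintype E']

/-- The restriction of a fundamental cocircuit vanishing on `A` is orthogonal to the minor of
rank two obtained by contracting `A`. -/
theorem perp_comp_of_mem_minor (hC : IsWeakMatroid C) (hM : IsUnderlyingMatroid M C)
    (hdisj : ∀ z, ι z ∉ A) {p q : E} (hB : M.IsBase (insert p (insert q A))) {A' : Set E}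
    {y : E → F} (hA' : IsHyperplaneBase M A') (hy : IsFundamentalCocircuit M C A' y)
    (hAA' : A ⊆ M.closure A') {Z : E' → F} (hZ : Z ∈ minor C A ι) : Perp Z (y ∘ ι) := by
  have h3 := ncard_support_le_three hM hdisj hB hZ
  obtain ⟨X, hX, hXs, rfl, -⟩ := hZ
  rw [perp_comp_iff_of_subset hXs fun e he => (hy.eq_zero_iff e).2 (hAA' he)]
  refine hy.perp_of_ncard_le_three hC hM hX hA' (le_trans ?_ h3)
  rw [← Set.ncard_image_of_injective _ ι.injective]
  refine Set.ncard_le_ncard (fun z hz => ?_) (Set.toFinite _)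
  exact (support_subset_of_comp hXs subset_rfl hz.1).resolve_left fun h => hz.2 (hAA' h)

/-- A vector of minimal support among those orthogonal to a rank-two minor is a multiple of the
restriction of a fundamental cocircuit. -/
theorem exists_eq_smul_fundamentalCocircuit (hC : IsWeakMatroid C) (hM : IsUnderlyingMatroid M C)
    (hdisj : ∀ z, ι z ∉ A) {p q : E'} (hpq : p ≠ q)
    (hB : M.IsBase (insert (ι p) (insert (ι q) A))) {y' : E' → F}
    (hy' : ∀ Z ∈ minor C A ι, Perp Z y') (hy0 : y' ≠ 0)
    (hmin : ∀ y'' : E' → F, (∀ Z ∈ minor C A ι, Perp Z y'') → y'' ≠ 0 →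
      ¬ Function.support y'' ⊂ Function.support y') :
    ∃ s y c, IsHyperplaneBase M (insert (ι s) A) ∧
      IsFundamentalCocircuit M C (insert (ι s) A) y ∧ y' = fun z => c * y (ι z) := by
  have hpqι : ι p ≠ ι q := fun h => hpq (ι.injective h)
  have hqA : M.Indep (insert (ι q) A) := hB.indep.subset (Set.subset_insert _ _)
  have hA : M.Indep A := hqA.subset (Set.subset_insert _ _)
  have hhyp : ∀ s, ι s ∉ M.closure A → IsHyperplaneBase M (insert (ι s) A) := fun s hs =>
    isHyperplaneBase_insert hB hpqι (hdisj p) (hdisj q) (hM.mem_ground _) hs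
  -- If `y'` were nonzero at every point off the closure of `A`, the fundamental cocircuit vanishing
  -- at `q` would have strictly smaller support.
  obtain ⟨s, hs, hys⟩ : ∃ s, ι s ∉ M.closure A ∧ y' s = 0 := by
    by_contra! hcon
    have hqcl : ι q ∉ M.closure A := (hA.insert_indep_iff_of_notMem (hdisj q)).1 hqA |>.2
    obtain ⟨y, hy⟩ := exists_isFundamentalCocircuit hC hM (hhyp q hqcl)
    refine hmin (y ∘ ι) (fun Z hZ => perp_comp_of_mem_minor hC hM hdisj hB (hhyp q hqcl) hy
      (fun z hz => M.mem_closure_of_mem (Or.inr hz) (hM.subset_ground _)) hZ) (fun h => ?_)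
      ⟨fun z hz => ?_, fun h => ?_⟩
    · have hp : y (ι p) = 0 := congrFun h p
      rw [hy.eq_zero_iff] at hp
      refine ((hqA.insert_indep_iff_of_notMem ?_).1 hB.indep).2 hp
      rintro (h | h)
      · exact hpqι h
      · exact hdisj p h
    · refine hcon z fun hcl => hz ?_
      exact (hy.eq_zero_iff _).2 (M.closure_subset_closure (Set.subset_insert _ _) hcl)
    · refine h (hcon q hqcl : q ∈ Function.support y') ?_
      exact (hy.eq_zero_iff _).2 (M.mem_closure_of_mem (Or.inl rfl) (hM.subset_ground _))
  have hH := hhyp s hs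
  obtain ⟨y, hy⟩ := exists_isFundamentalCocircuit hC hM hH
  -- A point `t` of this hyperplane lies on a circuit of the minor within `{t, s}`. Since `y'`
  -- vanishes at `s`, orthogonality leaves a single term, which must be zero.
  have hcl : ∀ t, y' t ≠ 0 → ι t ∉ M.closure (insert (ι s) A) := by
    intro t ht hcl
    have hts : t ≠ s := fun h => ht (h ▸ hys)
    have htn : ι t ∉ insert (ι s) A := by
      rintro (h | h)
      · exact hts (ι.injective h)
      · exact hdisj t h
    obtain ⟨X, hX, hXeq⟩ := hM.exists_of_isCircuit (hH.1.fundCircuit_isCircuit hcl htn)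
    have hXs := M.fundCircuit_subset_insert (ι t) (insert (ι s) A)
    rw [← hXeq] at hXs
    have hXs' : Function.support X ⊆ A ∪ ι '' {t, s} := by
      intro z hz
      rcases hXs hz with rfl | rfl | h
      · exact Or.inr ⟨t, Or.inl rfl, rfl⟩
      · exact Or.inr ⟨s, Or.inr rfl, rfl⟩
      · exact Or.inl h
    obtain ⟨Z, hZ, hZs⟩ := exists_mem_minor hX
      (hXs'.trans (Set.union_subset_union_right A (Set.image_subset_range ι _)))
    replace hZs := hZs.trans (support_comp_subset hdisj hXs')
    have hperp := hy' Z hZ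
    rw [Perp, hsum_eq_single t (Finset.mem_univ t)] at hperp
    · have hZt : Z t = 0 := (mul_eq_zero.1 (Set.mem_singleton_iff.1 hperp).symm).resolve_right ht
      obtain ⟨W, hW, hWs, rfl, -⟩ := hZ
      refine (hM.isCircuit hW).not_indep (hH.1.subset fun z hz => ?_)
      rcases support_subset_of_comp hWs hZs hz with h | ⟨r, rfl | rfl, rfl⟩
      · exact Or.inr h
      · exact absurd hZt hz
      · exact Or.inl rfl
    · intro r _ hrt
      by_cases hZr : Z r = 0
      · rw [hZr, zero_mul]
      · rcases hZs hZr with h | h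
        · exact absurd h hrt
        · rw [Set.mem_singleton_iff.1 h, hys, mul_zero]
  obtain ⟨t, ht⟩ := Function.ne_iff.1 hy0
  have htcl := hcl t ht
  have hyt : y (ι t) ≠ 0 := fun h => htcl ((hy.eq_zero_iff _).1 h)
  refine ⟨s, y, y' t / y (ι t), hH, hy, funext fun r => ?_⟩
  by_cases hrt : r = t
  · rw [hrt, div_mul_cancel₀ _ hyt]
  by_cases hr : ι r ∈ M.closure (insert (ι s) A)
  · rw [(hy.eq_zero_iff _).2 hr, mul_zero]
    by_contra h
    exact hcl r h hr
  have hrtι : ι r ≠ ι t := fun h => hrt (ι.injective h)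
  -- The circuit through `r` and `t` imposes the same two-term relation on `y'` and on `y`, which
  -- fixes the ratio.
  obtain ⟨K, hK, hKs⟩ := hH.exists_isCircuit (hM.mem_ground _) (hM.mem_ground _) hr htcl hrtι
  have hKr := mem_of_isCircuit_subset_insert hK (hH.isBase_insert (hM.mem_ground _) htcl).indep hKs
  obtain ⟨X, hX, rfl⟩ := hM.exists_of_isCircuit hK
  have hXr : X (ι r) ≠ 0 := hKr
  have hXZ : X ∘ ι ∈ minor C A ι := by
    refine mem_minor_of_subset_insert hM hdisj (T := {r, t, s})
      (hH.isBase_insert (hM.mem_ground _) htcl).indep (e := ι r) ?_ hX ?_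
    · rintro z (h | ⟨x, rfl | rfl | rfl, rfl⟩)
      · exact Or.inr (Or.inr (Or.inr h))
      · exact Or.inl rfl
      · exact Or.inr (Or.inl rfl)
      · exact Or.inr (Or.inr (Or.inl rfl))
    · intro z hz
      rcases hKs hz with rfl | rfl | rfl | h
      · exact Or.inr ⟨r, Or.inl rfl, rfl⟩
      · exact Or.inr ⟨t, Or.inr (Or.inl rfl), rfl⟩
      · exact Or.inr ⟨s, Or.inr (Or.inr rfl), rfl⟩
      · exact Or.inl h
  have h1 : X (ι r) * y' r = -(X (ι t) * y' t) := by
    refine (perp_iff_pair hrt fun x hxr hxt => ?_).1 (hy' _ hXZ)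
    by_cases hx : X (ι x) = 0
    · rw [Function.comp, hx, zero_mul]
    · rcases hKs hx with h | h | h | h
      · exact absurd (ι.injective h) hxr
      · exact absurd (ι.injective h) hxt
      · rw [ι.injective h, hys, mul_zero]
      · exact absurd h (hdisj x)
  have h2 := hy.balanced _ _ hrtι hr htcl X hX hKs
  apply mul_left_cancel₀ hXr
  rw [h1, mul_left_comm, h2, mul_neg, mul_left_comm (y' t / y (ι t)), div_mul_cancel₀ _ hyt]

end RankTwoMinor

/-! ### Orthogonality over perfect hyperfields. -/

section Perfect

variable {F : Type u} [Hyperfield F] {E : Type v} [Fintype E] {C : Set (E → F)} {M : Matroid E}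

/-- A weak matroid all of whose circuits have at most three elements is strong. -/
theorem IsWeakMatroid.isStrongMatroid_of_ncard_le_three (hC : IsWeakMatroid C)
    (h3 : ∀ X ∈ C, (Function.support X).ncard ≤ 3) : IsStrongMatroid C := by
  obtain ⟨M, hM⟩ := hC.exists_isUnderlyingMatroid
  refine hC.isStrongMatroid_of_perp hM fun A y hA hy X hX => ?_
  exact hy.perp_of_ncard_le_three hC hM hX hA
    ((Set.ncard_le_ncard Set.sdiff_subset (Set.toFinite _)).trans (h3 X hX))

/-- Over a perfect hyperfield, circuits are orthogonal to fundamental cocircuits. -/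
theorem IsPerfect.perp {τ : F → F} (hF : IsPerfect F τ) (hτ : IsInvolution τ)
    (hC : IsWeakMatroid C) (hM : IsUnderlyingMatroid M C) {A : Set E} {y : E → F}
    (hA : IsHyperplaneBase M A) (hy : IsFundamentalCocircuit M C A y) {X : E → F} (hX : X ∈ C) :
    Perp X y := by
  induction hn : (Function.support X \ M.closure A).ncard using Nat.strong_induction_on
    generalizing A y with
  | _ n ih =>
    by_cases h3 : (Function.support X \ M.closure A).ncard ≤ 3
    · exact hy.perp_of_ncard_le_three hC hM hX hA h3
    let S : Set E := Function.support X \ M.closure A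
    -- The third element `r` ensures that `p`, `q` and the part of `X` in the hyperplane form a
    -- proper subset of the circuit, hence an independent set.
    obtain ⟨p, q, r, hp, hq, hr, hpq, hpr, hqr⟩ :=
      (Set.two_lt_ncard_iff (Set.toFinite S)).1 ((show 2 < 3 by norm_num).trans (not_le.1 h3))
    have hAcl : A ⊆ M.closure A := M.subset_closure A (hM.subset_ground A)
    have hI : M.Indep (insert p (insert q (Function.support X ∩ M.closure A))) := by
      refine (hM.isCircuit hX).ssubset_indep ⟨?_, fun h => ?_⟩
      · exact Set.insert_subset hp.1 (Set.insert_subset hq.1 Set.inter_subset_left)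
      · rcases h hr.1 with h | h | h
        · exact hpr h.symm
        · exact hqr h.symm
        · exact hr.2 h.2
    have hspan : M.Spanning (insert p (insert q (M.closure A))) := by
      refine (hA.isBase_insert (hM.mem_ground p) hp.2).spanning_of_superset ?_ (hM.subset_ground _)
      exact Set.insert_subset_insert (hAcl.trans (Set.subset_insert _ _))
    obtain ⟨B, hB, hIB, hBs⟩ := hI.exists_isBase_subset_spanning hspan
      (Set.insert_subset_insert (Set.insert_subset_insert Set.inter_subset_right))
    let A₁ : Set E := B \ {p, q}
    have hA₁cl : A₁ ⊆ M.closure A := fun z hz =>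
      ((hBs hz.1).resolve_left fun h => hz.2 (Or.inl h)).resolve_left fun h => hz.2 (Or.inr h)
    have hBeq : insert p (insert q A₁) = B := by
      ext z
      simp only [A₁, Set.mem_insert_iff, Set.mem_sdiff, Set.mem_singleton_iff]
      constructor
      · rintro (rfl | rfl | h)
        · exact hIB (Or.inl rfl)
        · exact hIB (Or.inr (Or.inl rfl))
        · exact h.1
      · tauto
    -- Perfection is stated for ground sets in `Type`, so `S` is transported to `Fin m`.
    obtain ⟨m, ⟨φ⟩⟩ := Finite.exists_equiv_fin S
    let ι : Fin m ↪ E := φ.symm.toEmbedding.trans (Function.Embedding.subtype _)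
    have hιS : ∀ z, ι z ∈ S := fun z => (φ.symm z).2
    have hrange : ∀ z ∈ S, ∃ i, ι i = z := fun z hz => ⟨φ ⟨z, hz⟩, by simp [ι]⟩
    have hdisj : ∀ z, ι z ∉ A₁ := fun z hz => (hιS z).2 (hA₁cl hz)
    have hXs : Function.support X ⊆ A₁ ∪ Set.range ι := by
      intro z hz
      by_cases hzc : z ∈ M.closure A
      · refine Or.inl ⟨hIB (Or.inr (Or.inr ⟨hz, hzc⟩)), ?_⟩
        rintro (rfl | rfl)
        · exact hp.2 hzc
        · exact hq.2 hzc
      · exact Or.inr (hrange z ⟨hz, hzc⟩)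
    obtain ⟨p', rfl⟩ := hrange p hp
    obtain ⟨q', rfl⟩ := hrange q hq
    have hpq' : p' ≠ q' := fun h => hpq (h ▸ rfl)
    have hB' : M.IsBase (insert (ι p') (insert (ι q') A₁)) := hBeq ▸ hB
    have hN : IsStrongMatroid (minor C A₁ ι) :=
      (hC.minor hM (hB.indep.sdiff _) hdisj).isStrongMatroid_of_ncard_le_three
        fun Z hZ => ncard_support_le_three hM hdisj hB' hZ
    have hvec : IsVector τ (minor C A₁ ι) (X ∘ ι) := by
      rintro Y ⟨⟨hY, hY0⟩, hYmin⟩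
      have hττ : ∀ x : Fin m → F, τ ∘ τ ∘ x = x := fun x => funext fun z => hτ.involutive _
      have hsupp : ∀ x : Fin m → F, Function.support (τ ∘ x) = Function.support x := by
        intro x
        ext z
        refine not_congr ⟨fun h => ?_, fun h => ?_⟩
        · rw [← hτ.involutive (x z), show τ (x z) = 0 from h, hτ.map_zero]
        · rw [Function.comp, h, hτ.map_zero]
      have hne : ∀ x : Fin m → F, x ≠ 0 → τ ∘ x ≠ 0 := fun x hx h => hx <| by
        rw [← Function.support_eq_empty_iff, ← hsupp, h, Function.support_zero]
      obtain ⟨s, y', c, hA', hy', heq⟩ := exists_eq_smul_fundamentalCocircuit hC hM hdisj hpq' hB'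
        (y' := τ ∘ Y) (fun Z hZ => (orthogonal_iff_perp_left hτ).1 (hY Z hZ)) (hne Y hY0)
        (fun y'' hy'' hy0 hss => hYmin (τ ∘ y'') ⟨fun Z hZ => (orthogonal_iff_perp_left hτ).2
          (by rw [hττ]; exact hy'' Z hZ), hne y'' hy0⟩ (by rwa [hsupp, ← hsupp Y]))
      rw [orthogonal_iff_perp, heq]
      refine perp_smul_right (y := y' ∘ ι) ?_
      have hAcl' : A₁ ⊆ M.closure (insert (ι s) A₁) := fun z hz =>
        M.mem_closure_of_mem (Or.inr hz) (hM.subset_ground _)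
      rw [perp_comp_iff_of_subset hXs fun e he => (hy'.eq_zero_iff e).2 (hAcl' he)]
      -- The new hyperplane contains `A₁`, hence the part of `X` in the old one, and also `ι s`, so
      -- `X` has fewer elements outside it.
      refine ih _ (hn ▸ Set.ncard_lt_ncard ⟨fun z hz => ?_, fun h => ?_⟩ (Set.toFinite _)) hA' hy'
        rfl
      · rcases hXs hz.1 with h | ⟨i, rfl⟩
        · exact absurd (hAcl' h) hz.2
        · exact hιS i
      · exact (h (hιS s)).2 (M.mem_closure_of_mem (Or.inl rfl) (hM.subset_ground _))
    have hcov : IsCovector τ (minor C A₁ ι) (τ ∘ y ∘ ι) := by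
      intro Z hZ
      rw [orthogonal_iff_perp_left hτ]
      have : τ ∘ τ ∘ y ∘ ι = y ∘ ι := funext fun z => hτ.involutive _
      rw [this]
      exact perp_comp_of_mem_minor hC hM hdisj hB' hA hy hA₁cl hZ
    have h := hF (Fin m) _ hN _ _ hvec hcov
    rw [orthogonal_iff_perp] at h
    have hττ : τ ∘ τ ∘ y ∘ ι = y ∘ ι := funext fun z => hτ.involutive _
    rwa [hττ, perp_comp_iff_of_subset hXs fun e he => (hy.eq_zero_iff e).2 (hA₁cl he)] at h

end Perfect
end Hyperfield

theorem theorem5p4 {F : Type u} [Hyperfield F] (τ : F → F) (hτ : Hyperfield.IsInvolution τ)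
    (hF : Hyperfield.IsPerfect F τ) {E : Type v} [Finite E] (C : Set (E → F))
    (hC : Hyperfield.IsWeakMatroid C) : Hyperfield.IsStrongMatroid C := by
  have := Fintype.ofFinite E
  obtain ⟨M, hM⟩ := hC.exists_isUnderlyingMatroid
  exact hC.isStrongMatroid_of_perp hM fun A y hA hy X hX => hF.perp hτ hC hM hA hy hX
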